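/- Let $U\subset\mathbb R^n$ be open and connected with $0\in U$, let $a_i=e_{ii}$ be the diagonal matrix units and $\partial=\sum_j\partial/\partial x_j$. A metric $\sum_i h_i^2dx_i^2$ ($h_i$ smooth and nowhere zero) is a flat Egoroff metric on an open set if it is flat and $h_i^2=\partial\phi/\partial x_i$ for some smooth function $\phi$; it is $\partial$-invariant if $\partial h_i=0$ for all $i$. Its rotation coefficient matrix $\beta$ is $\beta_{ij}=(h_i)_{x_j}/h_j$ for $i\ne j$, $\beta_{ii}=0$, and its frame is the $GL(n,\mathbb C)$-valued map $E(x,\lambda)$, $\lambda\in\mathbb C$, smooth in $x$, with $E^{-1}dE=\sum_i(\lambda a_i+[a_i,\beta])dx_i$ and $E(0,\lambda)=\mathrm{Id}$. Its associated family is $X(x,\lambda)=-i\lambda^{-1}(E(x,i\lambda)h(x)-h(0))$, $\lambda\in\mathbb R\setminus\{0\}$. For a matrix $N$ with $N^2=0$ put $m_{\alpha,N}(\lambda)=\mathrm{Id}+(\lambda-\alpha)^{-1}N$. For $\alpha\in\mathbb R\setminus\{0\}$ and a real $n\times n$ matrix $N$ with $N^2=0$ let $$N'=\Big(\mathrm{Id}-\tfrac1{2\alpha}N\Big)\Big(\mathrm{Id}+\tfrac1{4\alpha^2}N^tN\Big)^{-1}N^t\Big(\mathrm{Id}+\tfrac1{2\alpha}N\Big),\qquad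 s_{\alpha,N}=m_{-\alpha,N'}\,m_{\alpha,N}.$$ Given the frame $E$, put $E_1(x)=\frac{d}{d\lambda}\big|_{\lambda=\alpha}E(x,\lambda)E(x,\alpha)^{-1}$, $\tilde N=E(x,\alpha)^{-1}(\mathrm{Id}+NE_1)^{-1}NE(x,\alpha)$, $\tilde E=m_{\alpha,N}Em_{\alpha,\tilde N}^{-1}$, $\tilde E_1(x)=\frac{d}{d\lambda}\big|_{\lambda=-\alpha}\tilde E(x,\lambda)\tilde E(x,-\alpha)^{-1}$, $\tilde N'=\tilde E(x,-\alpha)^{-1}(\mathrm{Id}+N'\tilde E_1)^{-1}N'\tilde E(x,-\alpha)$ and $$\hat E=s_{\alpha,N}*E=s_{\alpha,N}\,E\,m_{\alpha,\tilde N}^{-1}\,m_{-\alpha,\tilde N'}^{-1},$$ extended over its removable singularities $\lambda=\pm\alpha$. **Proposition.** Let $\sum_i h_i^2dx_i^2$ be a $\partial$-invariant flat Egoroff metric on $U$ with frame $E$, let $\hat E=s_{\alpha,N}*E$ with $\alpha,N$ as above, and let $\hat c\in\mathbb R^n$ be a constant vector with all entries nonzero (for example $\hat c=h(0)$). Let $V$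 be the set of all $x\in U$ at which $\mathrm{Id}+NE_1$ and $\mathrm{Id}+N'\tilde E_1$ are invertible and all components of $\hat E(x,0)^{-1}\hat c$ are nonzero. Then $V$ is an open neighbourhood of $0$; for every $x\in V$ the loop $\hat E(x,\cdot)$ is the result of the dressing action of $s_{\alpha,N}$ on $E(x,\cdot)$, i.e. $E(x,\cdot)$ and $\hat E(x,\cdot)$ are holomorphic maps $\mathbb C\to GL(n,\mathbb C)$, $s_{\alpha,N}$ is a rational loop equal to $\mathrm{Id}$ at $\infty$, and $s_{\alpha,N}E(x,\cdot)=\hat E(x,\cdot)\,\hat g$ for a rational loop $\hat g$ equal to $\mathrm{Id}$ at $\infty$; and $$\hat h(x)=\hat E(x,0)^{-1}\hat c$$ is real and defines a $\partial$-invariant flat Egoroff metric $\sum_i\hat h_i^2dx_i^2$ on $V$, with frame $\hat E$. For every $\lambda\in\mathbb R\setminus\{0\}$ the member $\hat X(\cdot,\lambda):V\to\mathbb C^n$ of its associated family is a Lagrangian immersion with flat induced metric, and $$\hat X(x,\lambda)=-i\lambda^{-1}\big(\hat E(x,i\lambda)\hat E(x,0)^{-1}\hat c-\hat c\big).$$ 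-/

import Mathlib

open scoped ContDiff Topology Matrix

noncomputable section

namespace FlatEgoroff

/-- The partial derivative `∂f/∂xᵢ` at `x`. -/
def pderiv {n : ℕ} {F : Type*} [NormedAddCommGroup F] [NormedSpace ℝ F]
    (f : (Fin n → ℝ) → F) (i : Fin n) (x : Fin n → ℝ) : F :=
  fderiv ℝ f x (Pi.single i 1)

/-- The partial derivative `∂M/∂xᵢ` of a matrix valued function, entry by entry. -/
def pderivMatrix {n : ℕ} (M : (Fin n → ℝ) → Matrix (Fin n) (Fin n) ℂ) (i : Fin n)
    (x : Fin n → ℝ) : Matrix (Fin n) (Fin n) ℂ :=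
  Matrix.of fun j k => pderiv (fun y => M y j k) i x

/-! ### Egoroff metrics -/

/-- The Riemannian metric `∑ gᵢⱼ dxᵢ dxⱼ` on the open set `U` is flat: near every point there is a
smooth map `y` to `ℝⁿ` that pulls the Euclidean metric back to it. -/
def IsFlatMetric {n : ℕ} (g : (Fin n → ℝ) → Matrix (Fin n) (Fin n) ℝ)
    (U : Set (Fin n → ℝ)) : Prop :=
  ∀ p ∈ U, ∃ W : Set (Fin n → ℝ), IsOpen W ∧ p ∈ W ∧ W ⊆ U ∧
    ∃ y : (Fin n → ℝ) → (Fin n → ℝ), ContDiffOn ℝ ∞ y W ∧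
      ∀ x ∈ W, ∀ i j, pderiv y i x ⬝ᵥ pderiv y j x = g x i j

/-- `∑ hᵢ² dxᵢ²` is a flat Egoroff metric on the open set `U`. -/
structure IsFlatEgoroffMetric {n : ℕ} (h : (Fin n → ℝ) → (Fin n → ℝ))
    (U : Set (Fin n → ℝ)) : Prop where
  smooth : ContDiffOn ℝ ∞ h U
  ne_zero : ∀ x ∈ U, ∀ i, h x i ≠ 0
  egoroff : ∃ φ : (Fin n → ℝ) → ℝ, ContDiffOn ℝ ∞ φ U ∧
    ∀ x ∈ U, ∀ i, h x i ^ 2 = pderiv φ i x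
  flat : IsFlatMetric (fun x => Matrix.diagonal fun i => h x i ^ 2) U

/-- `∂hᵢ = 0` on `U` for all `i`, where `∂ = ∑ⱼ ∂/∂xⱼ`. -/
def IsInvariant {n : ℕ} (h : (Fin n → ℝ) → (Fin n → ℝ)) (U : Set (Fin n → ℝ)) : Prop :=
  ∀ x ∈ U, ∀ i, ∑ j, pderiv (fun y => h y i) j x = 0

/-- The rotation coefficient matrix: `βᵢⱼ = (∂hᵢ/∂xⱼ) / hⱼ` for `i ≠ j`, and `βᵢᵢ = 0`. -/
def rotationMatrix {n : ℕ} (h : (Fin n → ℝ) → (Fin n → ℝ)) (x : Fin n → ℝ) :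
    Matrix (Fin n) (Fin n) ℝ :=
  Matrix.of fun i j => if i = j then 0 else pderiv (fun y => h y i) j x / h x j

/-- The coefficient `z aᵢ + [aᵢ, B]` of `dxᵢ`, where `aᵢ = eᵢᵢ`. -/
def connectionCoeff {n : ℕ} (B : Matrix (Fin n) (Fin n) ℝ) (i : Fin n) (z : ℂ) :
    Matrix (Fin n) (Fin n) ℂ :=
  z • Matrix.single i i (1 : ℂ) +
    (Matrix.single i i (1 : ℂ) * B.map Complex.ofReal -
      B.map Complex.ofReal * Matrix.single i i (1 : ℂ))

/-- `E(x, z)` is the frame of `β` on `U`: it is invertible, and for every `z` it satisfies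
`E⁻¹ dE = ∑ (z aᵢ + [aᵢ, β]) dxᵢ` and `E(0, z) = Id`. -/
structure IsFrame {n : ℕ} (β : (Fin n → ℝ) → Matrix (Fin n) (Fin n) ℝ)
    (E : (Fin n → ℝ) → ℂ → Matrix (Fin n) (Fin n) ℂ) (U : Set (Fin n → ℝ)) : Prop where
  smooth : ∀ z j k, ContDiffOn ℝ ∞ (fun x => E x z j k) U
  isUnit : ∀ x ∈ U, ∀ z, IsUnit (E x z)
  deriv_eq : ∀ x ∈ U, ∀ z i,
    (E x z)⁻¹ * pderivMatrix (fun y => E y z) i x = connectionCoeff (β x) i z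
  initial : ∀ z, E 0 z = 1

/-! ### Loops and dressing -/

/-- A positive loop: holomorphic on `ℂ` with values in `GL(n, ℂ)`. -/
def IsPositiveLoop {n : ℕ} (f : ℂ → Matrix (Fin n) (Fin n) ℂ) : Prop :=
  (∀ i j, Differentiable ℂ fun z => f z i j) ∧ ∀ z, IsUnit (f z)

/-- A negative rational loop: entries rational functions of `z` (values at the poles do not
matter), with value `Id` at infinity (so that it is invertible off a finite set). -/
def IsNegativeLoop {n : ℕ} (g : ℂ → Matrix (Fin n) (Fin n) ℂ) : Prop :=
  (∀ i j, ∃ p q : Polynomial ℂ, q ≠ 0 ∧ ∀ z, q.eval z ≠ 0 → g z i j = p.eval z / q.eval z) ∧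
    Filter.Tendsto g (Bornology.cobounded ℂ) (𝓝 1)

/-- `fhat = g * f` for the dressing action of the negative loop `g` on the positive loop `f`:
`g f = fhat ghat` as meromorphic functions, with `fhat` positive and `ghat` negative. -/
def IsDressing {n : ℕ} (g f fhat : ℂ → Matrix (Fin n) (Fin n) ℂ) : Prop :=
  IsNegativeLoop g ∧ IsPositiveLoop f ∧ IsPositiveLoop fhat ∧
    ∃ ghat : ℂ → Matrix (Fin n) (Fin n) ℂ, IsNegativeLoop ghat ∧
      ∀ᶠ z in Filter.cofinite, g z * f z = fhat z * ghat z

/-- The simple element `m_{a,1,N}(z) = Id + (z - a)⁻¹ N`. -/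
def simpleElement {n : ℕ} (a : ℂ) (N : Matrix (Fin n) (Fin n) ℂ) (z : ℂ) :
    Matrix (Fin n) (Fin n) ℂ :=
  1 + (z - a)⁻¹ • N

/-- The matrix `N'` for which `m_{-a,1,N'} m_{a,1,N}` satisfies the twisting condition. -/
def twistPartner {n : ℕ} (a : ℂ) (N : Matrix (Fin n) (Fin n) ℂ) : Matrix (Fin n) (Fin n) ℂ :=
  (1 - (1 / (2 * a)) • N) * (1 + (1 / (4 * a ^ 2)) • (Nᵀ * N))⁻¹ * Nᵀ * (1 + (1 / (2 * a)) • N)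

/-- `s_{a,N} = m_{-a,1,N'} m_{a,1,N}`. -/
def twistedElement {n : ℕ} (a : ℂ) (N : Matrix (Fin n) (Fin n) ℂ) (z : ℂ) :
    Matrix (Fin n) (Fin n) ℂ :=
  simpleElement (-a) (twistPartner a N) z * simpleElement a N z

/-- `d/dz` at `z = a` of `f(z) f(a)⁻¹`. -/
def normalizedDeriv {n : ℕ} (f : ℂ → Matrix (Fin n) (Fin n) ℂ) (a : ℂ) :
    Matrix (Fin n) (Fin n) ℂ :=
  Matrix.of fun j k => deriv (fun z => (f z * (f a)⁻¹) j k) a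

/-- `f(a)⁻¹ (Id + N f₁)⁻¹ N f(a)` with `f₁ = normalizedDeriv f a`; it is well-defined when
`Id + N f₁` is invertible. -/
def dressedNilpotent {n : ℕ} (a : ℂ) (N : Matrix (Fin n) (Fin n) ℂ)
    (f : ℂ → Matrix (Fin n) (Fin n) ℂ) : Matrix (Fin n) (Fin n) ℂ :=
  (f a)⁻¹ * (1 + N * normalizedDeriv f a)⁻¹ * N * f a

/-- The loop `m_{a,1,N} f m_{a,1,Ñ}⁻¹`, where `Ñ = dressedNilpotent a N f`, off its removable
singularity at `a`. -/
def dressOnce {n : ℕ} (a : ℂ) (N : Matrix (Fin n) (Fin n) ℂ)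
    (f : ℂ → Matrix (Fin n) (Fin n) ℂ) (z : ℂ) : Matrix (Fin n) (Fin n) ℂ :=
  simpleElement a N z * f z * (simpleElement a (dressedNilpotent a N f) z)⁻¹

/-- The matrices `Ñ(x)` and `Ñ'(x)` for dressing `f = E(x, ·)` with `s_{a,N}` are well-defined. -/
def DressingDefined {n : ℕ} (a : ℂ) (N : Matrix (Fin n) (Fin n) ℂ)
    (f : ℂ → Matrix (Fin n) (Fin n) ℂ) : Prop :=
  IsUnit (1 + N * normalizedDeriv f a) ∧
    IsUnit (1 + twistPartner a N * normalizedDeriv (dressOnce a N f) (-a))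

/-- The loop `s_{a,N} * f = m_{-a,1,N'} m_{a,1,N} f m_{a,1,Ñ}⁻¹ m_{-a,1,Ñ'}⁻¹`; the limit
extends the formula over the removable singularities at `a` and `-a`. -/
def dressed {n : ℕ} (a : ℂ) (N : Matrix (Fin n) (Fin n) ℂ)
    (f : ℂ → Matrix (Fin n) (Fin n) ℂ) (z : ℂ) : Matrix (Fin n) (Fin n) ℂ :=
  Filter.limUnder (𝓝[≠] z) fun w =>
    twistedElement a N w * f w * (simpleElement a (dressedNilpotent a N f) w)⁻¹ *
      (simpleElement (-a) (dressedNilpotent (-a) (twistPartner a N) (dressOnce a N f)) w)⁻¹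

/-- The frame `s_{a,N} * E` of the dressed metric, for real `a` and `N`. -/
def dressedFrame {n : ℕ} (a : ℝ) (N : Matrix (Fin n) (Fin n) ℝ)
    (E : (Fin n → ℝ) → ℂ → Matrix (Fin n) (Fin n) ℂ) (x : Fin n → ℝ) :
    ℂ → Matrix (Fin n) (Fin n) ℂ :=
  dressed (a : ℂ) (N.map Complex.ofReal) (E x)

/-- The vector `F(x, 0)⁻¹ c`. -/
def reconstruct {n : ℕ} (F : (Fin n → ℝ) → ℂ → Matrix (Fin n) (Fin n) ℂ) (c : Fin n → ℝ)
    (x : Fin n → ℝ) : Fin n → ℂ :=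
  (F x 0)⁻¹ *ᵥ fun i => (c i : ℂ)

/-- The points of `U` at which the dressing of `E` with `s_{a,N}` is well-defined and the
coefficients `Ehat(x, 0)⁻¹ c` of the new metric do not vanish. -/
def dressedDomain {n : ℕ} (a : ℝ) (N : Matrix (Fin n) (Fin n) ℝ)
    (E : (Fin n → ℝ) → ℂ → Matrix (Fin n) (Fin n) ℂ) (c : Fin n → ℝ)
    (U : Set (Fin n → ℝ)) : Set (Fin n → ℝ) :=
  {x | x ∈ U ∧ DressingDefined (a : ℂ) (N.map Complex.ofReal) (E x) ∧
    ∀ i, reconstruct (dressedFrame a N E) c x i ≠ 0}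

/-! ### Immersions into `ℂⁿ` -/

/-- The standard Hermitian product of `∂X/∂xᵢ` and `∂X/∂xⱼ`: its real part is the induced
metric, its imaginary part the pulled back symplectic form. -/
def hermitianForm {n : ℕ} (X : (Fin n → ℝ) → (Fin n → ℂ)) (i j : Fin n) (x : Fin n → ℝ) : ℂ :=
  star (pderiv X i x) ⬝ᵥ pderiv X j x

/-- `X : U → ℂⁿ` is a Lagrangian immersion whose induced metric is flat. -/
structure IsFlatLagrangianImmersion {n : ℕ} (X : (Fin n → ℝ) → (Fin n → ℂ))
    (U : Set (Fin n → ℝ)) : Prop where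
  smooth : ContDiffOn ℝ ∞ X U
  immersion : ∀ x ∈ U, Function.Injective (fderiv ℝ X x)
  lagrangian : ∀ x ∈ U, ∀ i j, (hermitianForm X i j x).im = 0
  flat : IsFlatMetric (fun x => Matrix.of fun i j => (hermitianForm X i j x).re) U

/-- The family `X(x, t) = -i t⁻¹ (E(x, i t) h(x) - h(0))` associated to a ∂-invariant flat Egoroff
metric with coefficients `h` and frame `E`. -/
def associatedFamily {n : ℕ} (E : (Fin n → ℝ) → ℂ → Matrix (Fin n) (Fin n) ℂ)
    (h : (Fin n → ℝ) → (Fin n → ℝ)) (t : ℝ) (x : Fin n → ℝ) : Fin n → ℂ :=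
  (-Complex.I * (t : ℂ)⁻¹) •
    (E x (Complex.I * t) *ᵥ (fun i => (h x i : ℂ)) - fun i => (h 0 i : ℂ))

end FlatEgoroff

end

/-! Consider solutions `F` of `F⁻¹ dF = z D + [D, B]`, `D = ∑ aᵢ dxᵢ`, that are holomorphic in `z`
and real (conjugating `z` conjugates `F`) and twisted (`F(z) F(-z)ᵗ = 1`). With a constant vector
`c`, such an `F` produces all the required geometry. The vector `h = F(x,0)⁻¹ c` satisfies `dh =
-[D, B] h`; hence the off-diagonal entries of `B` are the rotation coefficients of `h`, and `∂h = 0`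
since `∑ aᵢ = Id` commutes with `B`. The logarithmic `z`-derivative `F₁` at `0` satisfies `dF₁ = F D
F⁻¹`, so `y = F₁ c` has `dy = F(x,0) (hᵢ dxᵢ)`. As `F(x,0)` is real orthogonal, `y` is a flat
coordinate system and `c · y` is an Egoroff potential. The associated family is the difference
quotient of `F F(x,0)⁻¹` between `0` and `iλ`, applied to `c`; its differential is `F(x,iλ) (hᵢ
dxᵢ)` with `F(x,iλ)` unitary, so its Hermitian form is the real matrix `diag(hᵢ²)`.

It remains to see that dressing preserves such frames. For one simple factor, `Ñ` is the matrix that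
cancels the poles of `m E m̃⁻¹` and of its inverse (`dressedElement_relations`). It satisfies a
Riccati equation (`hasFDerivAt_dressedElement`), which makes the gauge transformation by `m̃⁻¹`
preserve the form of the connection and replace `B` by `B - Ñ` (`dress`). This is applied twice.
Since `N'` makes `s` real and twisted, both symmetries pass to the dressed loop by uniqueness of the
Birkhoff factorization, that is by Liouville's theorem (`birkhoff_unique`). The original frame has
them because the Egoroff potential makes `β` symmetric.

The given frame is only known to be smooth in `x` for each `z`. Holomorphy in `z`, and
differentiability in `x` of the `z`-derivative, come from locally uniform estimates for differences
in `z`, propagated from `x = 0` along the connected set `U`. -/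

noncomputable section

namespace FlatEgoroff

/-! ### Growth estimates for the frame equation in a Banach algebra -/

section BanachAlgebra

variable {X 𝔸 : Type*} [NormedAddCommGroup X] [NormedSpace ℝ X]
  [NormedRing 𝔸] [NormedAlgebra ℂ 𝔸]

/-- The `𝔸`-valued one-form `v ↦ z D(v) + [D(v), b]`. -/
def frameForm (D : X →L[ℝ] 𝔸) (b : 𝔸) (z : ℂ) : X →L[ℝ] 𝔸 :=
  z • D + (((ContinuousLinearMap.mul ℝ 𝔸).flip b).comp D - (ContinuousLinearMap.mul ℝ 𝔸 b).comp D)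

@[simp]
theorem frameForm_apply (D : X →L[ℝ] 𝔸) (b : 𝔸) (z : ℂ) (v : X) :
    frameForm D b z v = z • D v + (D v * b - b * D v) := rfl

/-- The one-form `v ↦ g η(v)`. -/
def leftMul (g : 𝔸) (η : X →L[ℝ] 𝔸) : X →L[ℝ] 𝔸 := (ContinuousLinearMap.mul ℝ 𝔸 g).comp η

@[simp]
theorem leftMul_apply (g : 𝔸) (η : X →L[ℝ] 𝔸) (v : X) : leftMul g η v = g * η v := rfl

theorem norm_leftMul_le (g : 𝔸) (η : X →L[ℝ] 𝔸) : ‖leftMul g η‖ ≤ ‖g‖ * ‖η‖ :=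
  ContinuousLinearMap.opNorm_le_bound _ (by positivity) fun v =>
    (norm_mul_le _ _).trans <| by
      rw [mul_assoc]
      exact mul_le_mul_of_nonneg_left (η.le_opNorm v) (norm_nonneg _)

theorem frameForm_sub_frameForm (D : X →L[ℝ] 𝔸) (b : 𝔸) (z w : ℂ) :
    frameForm D b z - frameForm D b w = (z - w) • D := by
  ext v
  simp only [sub_apply, frameForm_apply, smul_apply, sub_smul]
  abel

theorem norm_frameForm_le (D : X →L[ℝ] 𝔸) (b : 𝔸) (z : ℂ) :
    ‖frameForm D b z‖ ≤ (‖z‖ + 2 * ‖b‖) * ‖D‖ := by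
  refine ContinuousLinearMap.opNorm_le_bound _ (by positivity) fun v => ?_
  have h1 : ‖z • D v‖ ≤ ‖z‖ * ‖D v‖ := norm_smul_le _ _
  have h2 : ‖D v * b‖ ≤ ‖D v‖ * ‖b‖ := norm_mul_le _ _
  have h3 : ‖b * D v‖ ≤ ‖b‖ * ‖D v‖ := norm_mul_le _ _
  have h4 : ‖D v‖ ≤ ‖D‖ * ‖v‖ := D.le_opNorm v
  calc ‖frameForm D b z v‖ ≤ ‖z • D v‖ + (‖D v * b‖ + ‖b * D v‖) := by
        rw [frameForm_apply]
        exact (norm_add_le _ _).trans (add_le_add_right (norm_sub_le _ _) _)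
    _ ≤ (‖z‖ + 2 * ‖b‖) * ‖D v‖ := by linarith
    _ ≤ (‖z‖ + 2 * ‖b‖) * (‖D‖ * ‖v‖) := by gcongr
    _ = _ := by ring

/-- A substitute for Gronwall's inequality on a small ball. If `‖G‖` is maximal at `m`, the mean
value inequality gives `‖G m‖ ≤ ‖G x‖ + 2r(C‖G m‖ + δ)`, and `4rC ≤ 1` allows the term in `‖G m‖` to
be absorbed on the left. -/
theorem norm_le_of_linear_growth [ProperSpace X] {G : X → 𝔸} {η ρ : X → X →L[ℝ] 𝔸} {p : X}
    {r C δ : ℝ} (hC : 0 ≤ C) (hrC : 4 * (r * C) ≤ 1)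
    (hG : ∀ x ∈ Metric.closedBall p r, HasFDerivAt G (leftMul (G x) (η x) + ρ x) x)
    (hη : ∀ x ∈ Metric.closedBall p r, ‖η x‖ ≤ C)
    (hρ : ∀ x ∈ Metric.closedBall p r, ‖ρ x‖ ≤ δ)
    {x y : X} (hx : x ∈ Metric.closedBall p r) (hy : y ∈ Metric.closedBall p r) :
    ‖G y‖ ≤ 2 * ‖G x‖ + 4 * r * δ := by
  have hδ : 0 ≤ δ := (norm_nonneg _).trans (hρ x hx)
  have hcont : ContinuousOn (fun x => ‖G x‖) (Metric.closedBall p r) := fun x hx =>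
    (hG x hx).continuousAt.norm.continuousWithinAt
  obtain ⟨m, hm, hmax⟩ := (isCompact_closedBall p r).exists_isMaxOn ⟨x, hx⟩ hcont
  have hmax' : ∀ y ∈ Metric.closedBall p r, ‖G y‖ ≤ ‖G m‖ := fun y hy => hmax hy
  have hmvt := (convex_closedBall p r).norm_image_sub_le_of_norm_hasFDerivWithin_le
    (fun y hy => (hG y hy).hasFDerivWithinAt) (C := ‖G m‖ * C + δ) (fun y hy =>
      (norm_add_le _ _).trans (add_le_add ((norm_leftMul_le _ _).trans
        (mul_le_mul (hmax' y hy) (hη y hy) (norm_nonneg _) (norm_nonneg _))) (hρ y hy))) hx hm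
  have hd : ‖m - x‖ ≤ 2 * r := by
    rw [← dist_eq_norm]
    have h1 := Metric.mem_closedBall.1 hm
    have h2 := Metric.mem_closedBall'.1 hx
    linarith [dist_triangle m p x]
  have h3 : ‖G m‖ ≤ ‖G x‖ + ‖G m - G x‖ := by
    simpa using norm_add_le (G x) (G m - G x)
  have h4 : (‖G m‖ * C + δ) * ‖m - x‖ ≤ (‖G m‖ * C + δ) * (2 * r) := by gcongr
  have h5 : ‖G m‖ * (4 * (r * C)) ≤ ‖G m‖ * 1 := by gcongr
  have := hmax' y hy
  nlinarith

/-- The family `F` solves `F⁻¹ dF = z D + [D, B]` on `V` for all parameters `z ∈ S`. -/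
def SolvesFrame (D : X →L[ℝ] 𝔸) (B : X → 𝔸) (F : X → ℂ → 𝔸) (V : Set X) (S : Set ℂ) : Prop :=
  ∀ x ∈ V, ∀ z ∈ S, HasFDerivAt (fun y => F y z) (leftMul (F x z) (frameForm D (B x) z)) x

/-- Near every point, the dependence on the parameter of the solutions of a frame equation is
controlled by that at any single point. -/
theorem SolvesFrame.exists_ball_norm_sub_le [ProperSpace X] {D : X →L[ℝ] 𝔸} {B : X → 𝔸}
    {F : X → ℂ → 𝔸} {V : Set X} {S : Set ℂ} (hF : SolvesFrame D B F V S) (hV : IsOpen V)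
    (hB : ContinuousOn B V) (z₀ : ℂ) {p : X} (hp : p ∈ V) :
    ∃ r > 0, ∃ C, Metric.closedBall p r ⊆ V ∧ ∀ x ∈ Metric.closedBall p r,
      ∀ y ∈ Metric.closedBall p r, ∀ z ∈ S, ∀ w ∈ S, ‖z - z₀‖ ≤ 1 → ‖w - z₀‖ ≤ 1 →
        ‖F y z - F y w‖ ≤ 2 * ‖F x z - F x w‖ + C * ‖z - w‖ * ‖F x w‖ := by
  have hBp := hB.continuousAt (hV.mem_nhds hp)
  obtain ⟨r₁, hr₁, h₁⟩ := Metric.nhds_basis_closedBall.eventually_iff.1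
    ((hBp.norm.eventually (gt_mem_nhds (lt_add_one ‖B p‖))).and (hV.mem_nhds hp))
  set C := ((‖z₀‖ + 1) + 2 * (‖B p‖ + 1)) * ‖D‖ with hC
  have hC0 : 0 ≤ C := by positivity
  -- The second bound on the radius `r` ensures `4rC ≤ 1`. The constant `8‖D‖r` is the term `4rδ` of
  -- the growth estimate, for the `δ` used in the last step.
  refine ⟨min r₁ (1 / (4 * (C + 1))), by positivity, 8 * ‖D‖ * min r₁ (1 / (4 * (C + 1))),
    fun x hx => (h₁ (Metric.closedBall_subset_closedBall (min_le_left _ _) hx)).2, ?_⟩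
  set r := min r₁ (1 / (4 * (C + 1))) with hr
  have hr0 : 0 < r := by positivity
  have hrC : 4 * (r * C) ≤ 1 := by
    have h2 : r ≤ 1 / (4 * (C + 1)) := min_le_right _ _
    rw [le_div_iff₀ (by positivity)] at h2
    nlinarith
  have hsub : ∀ x ∈ Metric.closedBall p r, ‖B x‖ < ‖B p‖ + 1 ∧ x ∈ V := fun x hx =>
    h₁ (Metric.closedBall_subset_closedBall (min_le_left _ _) hx)
  have hη : ∀ z, ‖z - z₀‖ ≤ 1 → ∀ x ∈ Metric.closedBall p r, ‖frameForm D (B x) z‖ ≤ C := by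
    intro z hz x hx
    refine (norm_frameForm_le _ _ _).trans ?_
    have h2 := (hsub x hx).1.le
    have h3 : ‖z‖ ≤ ‖z₀‖ + 1 := by
      have := norm_add_le z₀ (z - z₀)
      rw [add_sub_cancel] at this
      linarith
    rw [hC]
    gcongr
  intro x hx y hy z hz w hw hz1 hw1
  have hbound : ∀ y ∈ Metric.closedBall p r, ‖F y w‖ ≤ 2 * ‖F x w‖ := by
    intro y hy
    have := norm_le_of_linear_growth (G := fun y => F y w) (ρ := fun _ => 0) (δ := 0) hC0 hrC
      (fun x hx => by simpa using hF x (hsub x hx).2 w hw) (hη w hw1) (by simp) hx hy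
    simpa using this
  -- The difference solves an inhomogeneous equation, `d(F_z - F_w) = (F_z - F_w) η_z + (z - w) F_w
  -- D`, whose source is of order `z - w`.
  have := norm_le_of_linear_growth (G := fun y => F y z - F y w) (η := fun y => frameForm D (B y) z)
      (ρ := fun y => leftMul (F y w) ((z - w) • D)) (δ := 2 * ‖F x w‖ * (‖z - w‖ * ‖D‖)) hC0 hrC
      (fun x hx => by
        refine ((hF x (hsub x hx).2 z hz).sub (hF x (hsub x hx).2 w hw)).congr_fderiv ?_
        rw [← frameForm_sub_frameForm D (B x) z w]
        ext v
        simp only [add_apply, sub_apply, leftMul_apply,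
          mul_sub, sub_mul]
        abel) (hη z hz1) (fun y hy => by
          refine (norm_leftMul_le _ _).trans ?_
          have := norm_smul_le (z - w) D
          have := hbound y hy
          gcongr) hx hy
  linarith

end BanachAlgebra

/-! ### Holomorphic dependence on the spectral parameter -/

section ParameterDependence
open Filter

theorem tendsto_parameter_bound {𝔸 : Type*} [NormedRing 𝔸] {f : ℂ → 𝔸} {z₀ : ℂ}
    (hf : ContinuousAt f z₀) (C : ℝ) :
    Tendsto (fun z => 2 * ‖f z - f z₀‖ + C * ‖z - z₀‖ * ‖f z₀‖) (𝓝 z₀) (𝓝 0) := by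
  have h1 : ContinuousAt (fun z => 2 * ‖f z - f z₀‖ + C * ‖z - z₀‖ * ‖f z₀‖) z₀ := by fun_prop
  simpa [ContinuousAt] using h1

theorem tendstoUniformlyOn_of_norm_sub_le {Y 𝔸 : Type*} [NormedRing 𝔸] {F : Y → ℂ → 𝔸} {s : Set Y} {f : ℂ → 𝔸}
    {z₀ : ℂ} (hf : ContinuousAt f z₀) {C : ℝ} {l : Filter ℂ} (hl : l ≤ 𝓝 z₀)
    (h : ∀ᶠ z in l, ∀ y ∈ s, ‖F y z - F y z₀‖ ≤ 2 * ‖f z - f z₀‖ + C * ‖z - z₀‖ * ‖f z₀‖) :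
    TendstoUniformlyOn (fun z y => F y z) (fun y => F y z₀) l s := by
  rw [Metric.tendstoUniformlyOn_iff]
  intro ε hε
  filter_upwards [h, ((tendsto_parameter_bound hf C).mono_left hl).eventually (gt_mem_nhds hε)]
    with z hz hzε y hy
  rw [dist_comm, dist_eq_norm]
  exact (hz y hy).trans_lt hzε

variable {X 𝔸 : Type*} [NormedAddCommGroup X] [NormedSpace ℝ X]
  [NormedRing 𝔸] [NormedAlgebra ℂ 𝔸]

/-- The one-form `v ↦ g D(v) k`. -/
def sandwich (g : 𝔸) (D : X →L[ℝ] 𝔸) (k : 𝔸) : X →L[ℝ] 𝔸 :=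
  leftMul g (((ContinuousLinearMap.mul ℝ 𝔸).flip k).comp D)

@[simp]
theorem sandwich_apply (g : 𝔸) (D : X →L[ℝ] 𝔸) (k : 𝔸) (v : X) :
    sandwich g D k v = g * D v * k := (mul_assoc _ _ _).symm

theorem norm_sandwich_sub_le (g g' : 𝔸) (D : X →L[ℝ] 𝔸) (k : 𝔸) :
    ‖sandwich g D k - sandwich g' D k‖ ≤ ‖g - g'‖ * ‖D‖ * ‖k‖ := by
  refine ContinuousLinearMap.opNorm_le_bound _ (by positivity) fun v => ?_
  have : (sandwich g D k - sandwich g' D k) v = (g - g') * D v * k := by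
    simp [sub_mul]
  rw [this]
  calc ‖(g - g') * D v * k‖ ≤ ‖g - g'‖ * ‖D v‖ * ‖k‖ := norm_mul₃_le
    _ ≤ ‖g - g'‖ * (‖D‖ * ‖v‖) * ‖k‖ := by gcongr; exact D.le_opNorm v
    _ = _ := by ring

section

variable {D : X →L[ℝ] 𝔸} {B : X → 𝔸} {F : X → ℂ → 𝔸} {V : Set X}

/-- A frame equation extends over a removable parameter value. -/
theorem SolvesFrame.of_compl_singleton [ProperSpace X] {z₀ : ℂ}
    (hF : SolvesFrame D B F V {z₀}ᶜ) (hV : IsOpen V)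
    (hB : ContinuousOn B V) (hc : ∀ x ∈ V, ContinuousAt (F x) z₀) :
    SolvesFrame D B F V Set.univ := by
  intro p hp z _
  by_cases hz : z ≠ z₀
  · exact hF p hp z hz
  obtain rfl : z = z₀ := not_not.1 hz
  obtain ⟨r, hr, C, hrV, hbd⟩ := hF.exists_ball_norm_sub_le hV hB z hp
  have hpr : p ∈ Metric.closedBall p r := Metric.mem_closedBall_self hr.le
  have hU : TendstoUniformlyOn (fun z y => F y z) (fun y => F y z) (𝓝[≠] z) (Metric.ball p r) := by
    refine tendstoUniformlyOn_of_norm_sub_le (hc p hp) (C := C) nhdsWithin_le_nhds ?_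
    filter_upwards [self_mem_nhdsWithin, nhdsWithin_le_nhds (Metric.closedBall_mem_nhds z one_pos)]
      with w hw hw1 y hy
    have hyr := Metric.ball_subset_closedBall hy
    have hy' := ((hc y (hrV hyr)).mono_left (nhdsWithin_le_nhds (s := {z}ᶜ)))
    have hp' := ((hc p hp).mono_left (nhdsWithin_le_nhds (s := {z}ᶜ)))
    have hid : Tendsto (fun w : ℂ => w) (𝓝[≠] z) (𝓝 z) := nhdsWithin_le_nhds
    -- The estimate is available only for parameters different from `z`, so it is used for `w, w' ≠
    -- z` and then `w'` tends to `z`.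
    refine le_of_tendsto_of_tendsto (hy'.const_sub (F y w)).norm
      (((hp'.const_sub (F p w)).norm.const_mul 2).add
        ((((hid.const_sub w).norm).const_mul C).mul hp'.norm)) ?_
    filter_upwards [self_mem_nhdsWithin, nhdsWithin_le_nhds (Metric.closedBall_mem_nhds z one_pos)]
      with w' hw' hw1'
    exact hbd p hpr y hyr w hw w' hw' (by simpa [dist_eq_norm] using hw1)
      (by simpa [dist_eq_norm] using hw1')
  have hcont : ContinuousAt (fun y => F y z) p := by
    refine (hU.continuousOn (Eventually.frequently ?_)).continuousAt (Metric.ball_mem_nhds p hr)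
    filter_upwards [self_mem_nhdsWithin] with w hw y hy
    exact (hF y (hrV (Metric.ball_subset_closedBall hy)) w hw).continuousAt.continuousWithinAt
  have hjoint : Tendsto (fun q : ℂ × X => F q.2 q.1) (𝓝[≠] z ×ˢ 𝓝 p) (𝓝 (F p z)) := by
    have h1 : TendstoUniformlyOnFilter (fun z y => F y z) (fun y => F y z) (𝓝[≠] z) (𝓝 p) :=
      hU.tendstoUniformlyOnFilter.mono_right (le_principal_iff.2 (Metric.ball_mem_nhds p hr))
    rw [Metric.tendsto_nhds]
    intro ε hε
    filter_upwards [Metric.tendstoUniformlyOnFilter_iff.1 h1 (ε / 2) (half_pos hε),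
      tendsto_snd.eventually (Metric.tendsto_nhds.1 hcont (ε / 2) (half_pos hε))] with q h1 h2
    have := dist_triangle (F q.2 q.1) (F q.2 z) (F p z)
    rw [dist_comm] at h1
    linarith
  have hBp := hB.continuousAt (hV.mem_nhds hp)
  have hform : Continuous fun q : 𝔸 × 𝔸 × ℂ => leftMul q.1 (frameForm D q.2.1 q.2.2) := by
    unfold leftMul frameForm
    fun_prop
  have hder : Tendsto (fun q : ℂ × X => leftMul (F q.2 q.1) (frameForm D (B q.2) q.1))
      (𝓝[≠] z ×ˢ 𝓝 p) (𝓝 (leftMul (F p z) (frameForm D (B p) z))) :=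
    (hform.tendsto (F p z, B p, z)).comp (hjoint.prodMk_nhds
      ((hBp.tendsto.comp tendsto_snd).prodMk_nhds (tendsto_fst.mono_right nhdsWithin_le_nhds)))
  have hder' : ContinuousAt (fun y => leftMul (F y z) (frameForm D (B y) z)) p :=
    hform.continuousAt.comp (hcont.prodMk (hBp.prodMk continuousAt_const))
  -- The derivatives for `w ≠ z` converge uniformly near `p` as `w` tends to `z`, by the joint limit
  -- `hder`; hence the limit is differentiable.
  refine hasFDerivAt_of_tendstoUniformlyOnFilter (l := 𝓝[≠] z) (f := fun w y => F y w)
    (f' := fun w y => leftMul (F y w) (frameForm D (B y) w))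
    (g' := fun y => leftMul (F y z) (frameForm D (B y) z)) ?_ ?_ ?_
  · rw [Metric.tendstoUniformlyOnFilter_iff]
    intro ε hε
    filter_upwards [Metric.tendsto_nhds.1 hder (ε / 2) (half_pos hε),
      tendsto_snd.eventually (Metric.tendsto_nhds.1 hder' (ε / 2) (half_pos hε))] with q h1 h2
    rw [dist_comm] at h1
    have := dist_triangle (leftMul (F q.2 z) (frameForm D (B q.2) z))
      (leftMul (F p z) (frameForm D (B p) z)) (leftMul (F q.2 q.1) (frameForm D (B q.2) q.1))
    linarith
  · filter_upwards [tendsto_fst.eventually (self_mem_nhdsWithin (a := z) (s := {z}ᶜ)),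
      tendsto_snd.eventually (hV.mem_nhds hp)] with q h1 h2
    exact hF q.2 h2 q.1 h1
  · filter_upwards [hV.mem_nhds hp] with y hy
    exact (hc y hy).mono_left nhdsWithin_le_nhds

theorem SolvesFrame.hasFDerivAt_inverse [CompleteSpace 𝔸] {S : Set ℂ} (hF : SolvesFrame D B F V S)
    {x : X} (hx : x ∈ V) {z : ℂ} (hz : z ∈ S) (hu : IsUnit (F x z)) :
    HasFDerivAt (fun y => Ring.inverse (F y z))
      (-((ContinuousLinearMap.mul ℝ 𝔸).flip (Ring.inverse (F x z))).comp (frameForm D (B x) z))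
      x := by
  obtain ⟨u, hu⟩ := hu
  have h1 := hF x hx z hz
  have h2 := hasFDerivAt_ringInverse (𝕜 := ℝ) u
  rw [hu] at h2
  refine (h2.comp x h1).congr_fderiv ?_
  ext v
  simp only [neg_apply, ContinuousLinearMap.comp_apply, ContinuousLinearMap.flip_apply,
    ContinuousLinearMap.mul_apply', ContinuousLinearMap.mulLeftRight_apply, leftMul_apply, ← hu,
    Ring.inverse_unit, ← mul_assoc, Units.inv_mul, one_mul]

/-- The connection forms at `z` and `z₀` differ by `(z - z₀) D`, so the terms containing `B` cancel
and the factor `z - z₀` cancels the denominator of the slope. The resulting derivative has no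
singularity as `z → z₀`. -/
theorem SolvesFrame.hasFDerivAt_slope [CompleteSpace 𝔸] {z₀ z : ℂ}
    (hF : SolvesFrame D B F V Set.univ) {x : X} (hx : x ∈ V) (hu : IsUnit (F x z₀)) (hz : z ≠ z₀) :
    HasFDerivAt (fun y => slope (fun w => F y w * Ring.inverse (F y z₀)) z₀ z)
      (sandwich (F x z) D (Ring.inverse (F x z₀))) x := by
  have hi := hF.hasFDerivAt_inverse hx (Set.mem_univ z₀) hu
  have h1 := ((hF x hx z trivial).mul' hi).sub ((hF x hx z₀ trivial).mul' hi)
  refine (h1.const_smul ((z - z₀)⁻¹)).congr_fderiv ?_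
  ext v
  have hne : z - z₀ ≠ 0 := sub_ne_zero.2 hz
  have h2 : (F x z * (-(frameForm D (B x) z₀ v * Ring.inverse (F x z₀))) +
      F x z * frameForm D (B x) z v * Ring.inverse (F x z₀)) -
      (F x z₀ * (-(frameForm D (B x) z₀ v * Ring.inverse (F x z₀))) +
      F x z₀ * frameForm D (B x) z₀ v * Ring.inverse (F x z₀)) =
      (z - z₀) • (F x z * D v * Ring.inverse (F x z₀)) := by
    have h3 : frameForm D (B x) z v = frameForm D (B x) z₀ v + (z - z₀) • D v := by
      simp only [frameForm_apply, sub_smul]; abel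
    rw [h3]
    simp only [mul_add, add_mul, mul_smul_comm, smul_mul_assoc, mul_neg, mul_assoc]
    abel
  simp only [smul_apply, sub_apply, add_apply, neg_apply,
    ContinuousLinearMap.comp_apply, ContinuousLinearMap.flip_apply, ContinuousLinearMap.mul_apply',
    leftMul_apply, sandwich_apply, smul_eq_mul, MulOpposite.smul_eq_mul_unop, MulOpposite.unop_op]
  rw [h2, smul_smul, inv_mul_cancel₀ hne, one_smul]

/-- Difference quotients in the parameter have locally uniformly convergent derivatives. -/
theorem SolvesFrame.exists_ball_tendstoUniformlyOn [ProperSpace X] [CompleteSpace 𝔸] {z₀ : ℂ}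
    (hF : SolvesFrame D B F V Set.univ) (hV : IsOpen V) (hB : ContinuousOn B V)
    (hu : ∀ x ∈ V, IsUnit (F x z₀)) {p : X} (hp : p ∈ V) :
    ∃ r > 0, Metric.ball p r ⊆ V ∧ ∀ x ∈ Metric.ball p r, ContinuousAt (F x) z₀ →
      TendstoUniformlyOn (fun z y => sandwich (F y z) D (Ring.inverse (F y z₀)))
        (fun y => sandwich (F y z₀) D (Ring.inverse (F y z₀))) (𝓝 z₀) (Metric.ball p r) := by
  obtain ⟨r, hr, C, hrV, hbd⟩ := hF.exists_ball_norm_sub_le hV hB z₀ hp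
  have hinv := (hF.hasFDerivAt_inverse hp trivial (hu p hp)).continuousAt
  set M := ‖Ring.inverse (F p z₀)‖ + 1 with hM
  have hM0 : 0 < M := by positivity
  obtain ⟨r₁, hr₁, h₁⟩ := Metric.nhds_basis_ball.eventually_iff.1
    (hinv.norm.eventually (gt_mem_nhds (lt_add_one ‖Ring.inverse (F p z₀)‖)))
  have hs1 : Metric.ball p (min r r₁) ⊆ Metric.closedBall p r :=
    (Metric.ball_subset_ball (min_le_left _ _)).trans Metric.ball_subset_closedBall
  refine ⟨min r r₁, lt_min hr hr₁, hs1.trans hrV, fun x hx hc => ?_⟩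
  have hU : TendstoUniformlyOn (fun z y => F y z) (fun y => F y z₀) (𝓝 z₀)
      (Metric.ball p (min r r₁)) := by
    refine tendstoUniformlyOn_of_norm_sub_le hc (C := C) le_rfl ?_
    filter_upwards [Metric.closedBall_mem_nhds z₀ one_pos] with w hw y hy
    exact hbd x (hs1 hx) y (hs1 hy) w trivial z₀ trivial (by simpa [dist_eq_norm] using hw)
      (by simp)
  rw [Metric.tendstoUniformlyOn_iff] at hU ⊢
  intro ε hε
  filter_upwards [hU (ε / (‖D‖ * M + 1)) (by positivity)] with z hz y hy
  have h2 := hz y hy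
  have h3 : ‖Ring.inverse (F y z₀)‖ ≤ M :=
    (h₁ (Metric.ball_subset_ball (min_le_right _ _) hy)).le
  rw [dist_eq_norm] at h2 ⊢
  rw [lt_div_iff₀ (by positivity)] at h2
  calc _ ≤ ‖F y z₀ - F y z‖ * ‖D‖ * ‖Ring.inverse (F y z₀)‖ := norm_sandwich_sub_le _ _ _ _
    _ ≤ ‖F y z₀ - F y z‖ * ‖D‖ * M := by gcongr
    _ ≤ ‖F y z₀ - F y z‖ * (‖D‖ * M + 1) := by
        rw [mul_assoc]
        exact mul_le_mul_of_nonneg_left (le_add_of_nonneg_right zero_le_one) (norm_nonneg _)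
    _ < ε := h2

/-- The logarithmic derivative of `f` at `a`, with the factor `f(a)⁻¹` on the right. -/
def logDerivAt (f : ℂ → 𝔸) (a : ℂ) : 𝔸 := deriv f a * Ring.inverse (f a)

theorem hasDerivAt_mul_inverse {f : ℂ → 𝔸} {a : ℂ} (hf : DifferentiableAt ℂ f a) :
    HasDerivAt (fun w => f w * Ring.inverse (f a)) (logDerivAt f a) a :=
  hf.hasDerivAt.mul_const _

/-- Limit of `hasFDerivAt_slope` as `z → z₀`. At a dressing pole this formula drives the Riccati
equation; at `z₀ = 0` it yields the flat coordinates. -/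
theorem SolvesFrame.hasFDerivAt_logDerivAt [ProperSpace X] [CompleteSpace 𝔸] {z₀ : ℂ}
    (hF : SolvesFrame D B F V Set.univ) (hV : IsOpen V) (hB : ContinuousOn B V)
    (hu : ∀ x ∈ V, IsUnit (F x z₀)) (hd : ∀ x ∈ V, DifferentiableAt ℂ (F x) z₀)
    {p : X} (hp : p ∈ V) :
    HasFDerivAt (fun x => logDerivAt (F x) z₀)
      (sandwich (F p z₀) D (Ring.inverse (F p z₀))) p := by
  obtain ⟨r, hr, hrV, hunif⟩ := hF.exists_ball_tendstoUniformlyOn hV hB hu hp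
  have hU := hunif p (Metric.mem_ball_self hr) (hd p hp).continuousAt
  refine hasFDerivAt_of_tendstoUniformlyOnFilter (l := 𝓝[≠] z₀)
    (f := fun z y => slope (fun w => F y w * Ring.inverse (F y z₀)) z₀ z)
    (f' := fun z y => sandwich (F y z) D (Ring.inverse (F y z₀)))
    (g' := fun y => sandwich (F y z₀) D (Ring.inverse (F y z₀))) ?_ ?_ ?_
  · exact (hU.tendstoUniformlyOnFilter.mono_left nhdsWithin_le_nhds).mono_right
      (le_principal_iff.2 (Metric.ball_mem_nhds p hr))
  · filter_upwards [tendsto_fst.eventually (self_mem_nhdsWithin (a := z₀) (s := {z₀}ᶜ)),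
      tendsto_snd.eventually (hV.mem_nhds hp)] with q h1 h2
    exact hF.hasFDerivAt_slope h2 (hu _ h2) h1
  · filter_upwards [hV.mem_nhds hp] with y hy
    exact hasDerivAt_iff_tendsto_slope.1 (hasDerivAt_mul_inverse (hd y hy))

/-- On a connected set, the solution of a frame equation depends holomorphically on the parameter
if it does so at one point. -/
theorem SolvesFrame.differentiableAt [ProperSpace X] [CompleteSpace 𝔸] {z₀ : ℂ}
    (hF : SolvesFrame D B F V Set.univ) (hV : IsOpen V) (hVc : IsPreconnected V)
    (hB : ContinuousOn B V) (hu : ∀ x ∈ V, IsUnit (F x z₀)) {x₀ : X} (hx₀ : x₀ ∈ V)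
    (hd : DifferentiableAt ℂ (F x₀) z₀) {x : X} (hx : x ∈ V) : DifferentiableAt ℂ (F x) z₀ := by
  refine hVc.induction₂' (fun x y => DifferentiableAt ℂ (F x) z₀ → DifferentiableAt ℂ (F y) z₀)
    (fun p hp => ?_) (fun _ _ _ _ _ _ h1 h2 h3 => h2 (h1 h3)) hx₀ hx hd
  obtain ⟨r, hr, hrV, hunif⟩ := hF.exists_ball_tendstoUniformlyOn hV hB hu hp
  have key : ∀ x ∈ Metric.ball p r, ∀ y ∈ Metric.ball p r, DifferentiableAt ℂ (F x) z₀ →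
      DifferentiableAt ℂ (F y) z₀ := by
    intro x hx y hy hdx
    -- The slope from `z₀` to itself is `0` by convention, so its derivative must be set to `0`
    -- there. Limits along the punctured filter do not see this value.
    set f' : ℂ → X → X →L[ℝ] 𝔸 := fun z y =>
      if z = z₀ then 0 else sandwich (F y z) D (Ring.inverse (F y z₀)) with hf'
    have h1 : TendstoUniformlyOn f' (fun y => sandwich (F y z₀) D (Ring.inverse (F y z₀)))
        (𝓝[≠] z₀) (Metric.ball p r) := by
      refine TendstoUniformlyOn.congr (F := fun z y => sandwich (F y z) D (Ring.inverse (F y z₀)))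
        (fun u hu => nhdsWithin_le_nhds (hunif x hx hdx.continuousAt u hu)) ?_
      filter_upwards [self_mem_nhdsWithin] with z hz y hy
      simp only [hf']
      rw [if_neg (show z ≠ z₀ from hz)]
    -- Uniform convergence of the derivatives carries the Cauchy property of the slopes from `x` to
    -- every `y` in the ball.
    have h2 := cauchy_map_of_uniformCauchySeqOn_fderiv (𝕜 := ℝ)
      (f := fun z y => slope (fun w => F y w * Ring.inverse (F y z₀)) z₀ z) Metric.isOpen_ball
      (convex_ball p r).isPreconnected h1.uniformCauchySeqOn (fun z y hy => by
        simp only [hf']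
        split_ifs with h
        · subst h
          simpa using hasFDerivAt_const (0 : 𝔸) y
        · exact hF.hasFDerivAt_slope (hrV hy) (hu y (hrV hy)) h) hx hy
      (hasDerivAt_iff_tendsto_slope.1 (hasDerivAt_mul_inverse hdx)).cauchy_map
    obtain ⟨c, hc⟩ := cauchy_map_iff_exists_tendsto.1 h2
    have h3 : DifferentiableAt ℂ (fun w => F y w * Ring.inverse (F y z₀)) z₀ :=
      (hasDerivAt_iff_tendsto_slope.2 hc).differentiableAt
    refine (h3.mul_const (F y z₀)).congr_of_eventuallyEq (Eventually.of_forall fun w => ?_)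
    simp [mul_assoc, Ring.inverse_mul_cancel _ (hu y (hrV hy))]
  filter_upwards [nhdsWithin_le_nhds (Metric.ball_mem_nhds p hr)] with y hy
  exact ⟨key p (Metric.mem_ball_self hr) y hy, key y hy p (Metric.mem_ball_self hr)⟩

end
end ParameterDependence

/-! ### Dressing of a single loop by a simple element -/

section LoopDressing
open Filter

variable {𝔸 : Type*} [NormedRing 𝔸] [NormedAlgebra ℂ 𝔸]

/-- The extension of `(1 + (z - a)⁻¹ P) f(z) (1 - (z - a)⁻¹ Q)` over its singularity at `a`, when
this singularity is removable. -/
def dressedLoop (a : ℂ) (P Q : 𝔸) (f : ℂ → 𝔸) (z : ℂ) : 𝔸 :=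
  f z + P * dslope f a z - dslope f a z * Q - P * dslope (dslope f a) a z * Q

/-- The hypotheses say that the coefficients of `(z - a)⁻²` and `(z - a)⁻¹` in the product on the
right vanish; the difference quotients in `dressedLoop` are the regular remainder. -/
theorem dressedLoop_eq {a : ℂ} {P Q : 𝔸} {f : ℂ → 𝔸} (h₂ : P * f a * Q = 0)
    (h₁ : P * f a - f a * Q - P * deriv f a * Q = 0) {z : ℂ} (hz : z ≠ a) :
    dressedLoop a P Q f z = (1 + (z - a)⁻¹ • P) * f z * (1 - (z - a)⁻¹ • Q) := by
  have hne : z - a ≠ 0 := sub_ne_zero.2 hz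
  have hf : f z = f a + (z - a) • dslope f a z := by simp
  have hf' : dslope f a z = deriv f a + (z - a) • dslope (dslope f a) a z := by
    simp
  rw [dressedLoop]
  generalize dslope (dslope f a) a z = q at *
  generalize dslope f a z = r at *
  rw [hf, hf']
  generalize deriv f a = f' at *
  generalize f a = g at *
  simp only [add_mul, mul_add, mul_sub, one_mul, mul_one, smul_mul_assoc, mul_smul_comm] at *
  have e1 : P * g = g * Q + P * f' * Q := by rw [sub_sub, sub_eq_zero] at h₁; exact h₁
  rw [h₂, e1]
  match_scalars <;> field_simp <;> ring

theorem differentiable_dressedLoop [CompleteSpace 𝔸] {a : ℂ} {P Q : 𝔸} {f : ℂ → 𝔸}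
    (hf : Differentiable ℂ f) : Differentiable ℂ (dressedLoop a P Q f) := by
  have h : ∀ f : ℂ → 𝔸, Differentiable ℂ f → Differentiable ℂ (dslope f a) := fun f hf =>
    differentiableOn_univ.1 ((Complex.differentiableOn_dslope univ_mem).2 hf.differentiableOn)
  have h1 := h f hf
  have h2 := h _ h1
  unfold dressedLoop
  fun_prop

/-- The element `f(a)⁻¹ (1 + N f₁)⁻¹ N f(a)`, where `f₁` is the logarithmic derivative of `f`. -/
def dressedElement (a : ℂ) (N : 𝔸) (f : ℂ → 𝔸) : 𝔸 :=
  Ring.inverse (f a) * (Ring.inverse (1 + N * logDerivAt f a) * N) * f a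

/-- All follow from `uN + Nt(uN) = N`, its mirror image, and `N² = 0`. Conjugated by `f(a)`, with
`t` the logarithmic derivative, they become the pole cancellations below. -/
theorem nilpotent_relations {R : Type*} [Ring R] {N t u : R} (hN : N * N = 0)
    (hu : (1 + N * t) * u = 1) (hu' : u * (1 + N * t) = 1) :
    N * (u * N) = 0 ∧ (u * N) * N = 0 ∧ (u * N) * (u * N) = 0 ∧
      N - u * N - N * t * (u * N) = 0 ∧ u * N - N + (u * N) * t * N = 0 := by
  have h1 : u * N + N * t * (u * N) = N := by
    calc _ = ((1 + N * t) * u) * N := by noncomm_ring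
      _ = N := by rw [hu, one_mul]
  have h2 : N * (u * N) = 0 := by
    calc N * (u * N) = N * (u * N + N * t * (u * N)) - (N * N) * (t * (u * N)) := by noncomm_ring
      _ = 0 := by rw [h1, hN, zero_mul, sub_zero]
  have h3 : (u * N) * N = 0 := by rw [mul_assoc, hN, mul_zero]
  refine ⟨h2, h3, by rw [mul_assoc, h2, mul_zero], ?_, ?_⟩
  · rw [sub_sub, h1, sub_self]
  · calc u * N - N + (u * N) * t * N = (u * (1 + N * t)) * N - N := by noncomm_ring
      _ = 0 := by rw [hu', one_mul, sub_self]

section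

variable {a : ℂ} {N : 𝔸} {f : ℂ → 𝔸} (hN : N * N = 0) (hu : IsUnit (f a))
  (h1 : IsUnit (1 + N * logDerivAt f a))

include hN hu h1

/-- The first two relations remove the poles of `m_N f m_Q⁻¹`, and the last two remove those of the
inverse loop `m_Q f⁻¹ m_N⁻¹`. The third gives `m_Q⁻¹ = 1 - (z - a)⁻¹ Q`. -/
theorem dressedElement_relations :
    N * f a * dressedElement a N f = 0 ∧
    N * f a - f a * dressedElement a N f - N * deriv f a * dressedElement a N f = 0 ∧
    dressedElement a N f * dressedElement a N f = 0 ∧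
    dressedElement a N f * Ring.inverse (f a) * N = 0 ∧
    dressedElement a N f * Ring.inverse (f a) - Ring.inverse (f a) * N +
      dressedElement a N f * (Ring.inverse (f a) * deriv f a * Ring.inverse (f a)) * N = 0 := by
  obtain ⟨r1, r2, r3, r4, r5⟩ := nilpotent_relations hN (Ring.mul_inverse_cancel _ h1)
    (Ring.inverse_mul_cancel _ h1)
  have e1 := Ring.mul_inverse_cancel _ hu
  have e2 := Ring.inverse_mul_cancel _ hu
  have ed : deriv f a = logDerivAt f a * f a := by
    rw [logDerivAt, mul_assoc, e2, mul_one]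
  rw [dressedElement, ed]
  generalize Ring.inverse (1 + N * logDerivAt f a) * N = K at *
  generalize logDerivAt f a = t at *
  generalize Ring.inverse (f a) = j at *
  generalize f a = g at *
  refine ⟨?_, ?_, ?_, ?_, ?_⟩
  · calc N * g * (j * K * g) = N * (g * j) * K * g := by noncomm_ring
      _ = 0 := by rw [e1, mul_one, r1, zero_mul]
  · calc N * g - g * (j * K * g) - N * (t * g) * (j * K * g)
        = N * g - (g * j) * K * g - N * t * (g * j) * K * g := by noncomm_ring
      _ = (N - K - N * t * K) * g := by rw [e1]; noncomm_ring
      _ = 0 := by rw [r4, zero_mul]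
  · calc j * K * g * (j * K * g) = j * K * (g * j) * K * g := by noncomm_ring
      _ = j * (K * K) * g := by rw [e1]; noncomm_ring
      _ = 0 := by rw [r3, mul_zero, zero_mul]
  · calc j * K * g * j * N = j * K * (g * j) * N := by noncomm_ring
      _ = j * (K * N) := by rw [e1]; noncomm_ring
      _ = 0 := by rw [r2, mul_zero]
  · calc j * K * g * j - j * N + j * K * g * (j * (t * g) * j) * N
        = j * K * (g * j) - j * N + j * K * (g * j) * t * (g * j) * N := by noncomm_ring
      _ = j * (K - N + K * t * N) := by rw [e1]; noncomm_ring
      _ = 0 := by rw [r5, mul_zero]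

theorem dressedLoop_dressedElement {z : ℂ} (hz : z ≠ a) :
    dressedLoop a N (dressedElement a N f) f z =
      (1 + (z - a)⁻¹ • N) * f z * (1 - (z - a)⁻¹ • dressedElement a N f) :=
  dressedLoop_eq (dressedElement_relations hN hu h1).1 (dressedElement_relations hN hu h1).2.1 hz

end

theorem one_add_smul_mul_one_sub_smul {N : 𝔸} (hN : N * N = 0) (c : ℂ) :
    (1 + c • N) * (1 - c • N) = 1 := by
  simp [add_mul, mul_sub, hN]

theorem one_sub_smul_mul_one_add_smul {N : 𝔸} (hN : N * N = 0) (c : ℂ) :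
    (1 - c • N) * (1 + c • N) = 1 := by
  simp [sub_mul, mul_add, hN]

/-- The inverse is `f⁻¹` dressed with the roles of `N` and `Q` exchanged. Both products equal `1`
off `a`, hence also at `a` by continuity. -/
theorem isUnit_dressedLoop [CompleteSpace 𝔸] {a : ℂ} {N : 𝔸} {f : ℂ → 𝔸} (hN : N * N = 0)
    (hf : Differentiable ℂ f) (hu : ∀ z, IsUnit (f z)) (h1 : IsUnit (1 + N * logDerivAt f a))
    (z : ℂ) : IsUnit (dressedLoop a N (dressedElement a N f) f z) := by
  set Q := dressedElement a N f with hQ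
  set g : ℂ → 𝔸 := fun z => Ring.inverse (f z) with hg
  obtain ⟨-, -, r3, r4, r5⟩ := dressedElement_relations hN (hu a) h1
  rw [← hQ] at r3 r4 r5
  have hgd : ∀ z, HasDerivAt g (-(Ring.inverse (f z) * deriv f z * Ring.inverse (f z))) z := by
    intro z
    obtain ⟨u, hu⟩ := hu z
    have h2 := hasFDerivAt_ringInverse (𝕜 := ℂ) u
    rw [hu] at h2
    refine (h2.comp_hasDerivAt z (hf z).hasDerivAt).congr_deriv ?_
    simp [← hu]
  have hgdiff : Differentiable ℂ g := fun z => (hgd z).differentiableAt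
  have hH : ∀ z, z ≠ a → dressedLoop a Q N g z =
      (1 + (z - a)⁻¹ • Q) * g z * (1 - (z - a)⁻¹ • N) := fun z hz =>
    dressedLoop_eq r4 (by rw [(hgd a).deriv, mul_neg, neg_mul, sub_neg_eq_add]; exact r5) hz
  have hG : ∀ z, z ≠ a → dressedLoop a N Q f z =
      (1 + (z - a)⁻¹ • N) * f z * (1 - (z - a)⁻¹ • Q) := fun z hz =>
    dressedLoop_dressedElement hN (hu a) h1 hz
  have hGc := (differentiable_dressedLoop (a := a) (P := N) (Q := Q) hf).continuous
  have hHc := (differentiable_dressedLoop (a := a) (P := Q) (Q := N) hgdiff).continuous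
  have hGH : (fun z => dressedLoop a N Q f z * dressedLoop a Q N g z) = fun _ => 1 := by
    refine (hGc.mul hHc).ext_on (dense_compl_singleton a) continuous_const fun z hz => ?_
    rw [Pi.mul_apply, hG z hz, hH z hz]
    calc _ = (1 + (z - a)⁻¹ • N) * f z * ((1 - (z - a)⁻¹ • Q) * (1 + (z - a)⁻¹ • Q)) * g z *
          (1 - (z - a)⁻¹ • N) := by simp only [mul_assoc]
      _ = 1 := by
          rw [one_sub_smul_mul_one_add_smul r3, mul_one, mul_assoc (_ * _),
            mul_assoc (1 + _), ← mul_assoc (f z), Ring.mul_inverse_cancel _ (hu z), one_mul,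
            one_add_smul_mul_one_sub_smul hN]
  have hHG : (fun z => dressedLoop a Q N g z * dressedLoop a N Q f z) = fun _ => 1 := by
    refine (hHc.mul hGc).ext_on (dense_compl_singleton a) continuous_const fun z hz => ?_
    rw [Pi.mul_apply, hG z hz, hH z hz]
    calc _ = (1 + (z - a)⁻¹ • Q) * g z * ((1 - (z - a)⁻¹ • N) * (1 + (z - a)⁻¹ • N)) * f z *
          (1 - (z - a)⁻¹ • Q) := by simp only [mul_assoc]
      _ = 1 := by
          rw [one_sub_smul_mul_one_add_smul hN, mul_one, mul_assoc (_ * _),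
            mul_assoc (1 + _), ← mul_assoc (g z), Ring.inverse_mul_cancel _ (hu z), one_mul,
            one_add_smul_mul_one_sub_smul r3]
  exact ⟨⟨_, _, congrFun hGH z, congrFun hHG z⟩, rfl⟩

/-- Uniqueness in the Birkhoff factorization. -/
theorem birkhoff_unique [CompleteSpace 𝔸] {f₁ f₂ g₁ g₂ : ℂ → 𝔸} (hf₁ : Differentiable ℂ f₁)
    (hf₂ : Differentiable ℂ f₂) (hu₂ : ∀ z, IsUnit (f₂ z))
    (hg₁ : Tendsto g₁ (Bornology.cobounded ℂ) (𝓝 1))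
    (hg₂ : Tendsto g₂ (Bornology.cobounded ℂ) (𝓝 1))
    (h : ∀ᶠ z in Bornology.cobounded ℂ, f₁ z * g₁ z = f₂ z * g₂ z) : f₁ = f₂ := by
  have hk : Differentiable ℂ fun z => Ring.inverse (f₂ z) * f₁ z := by
    refine Differentiable.mul (fun z => ?_) hf₁
    obtain ⟨u, hu⟩ := hu₂ z
    have h2 := hasFDerivAt_ringInverse (𝕜 := ℂ) u
    rw [hu] at h2
    exact h2.differentiableAt.comp z (hf₂ z)
  have hinv : Tendsto (fun z => Ring.inverse (g₁ z)) (Bornology.cobounded ℂ) (𝓝 1) := by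
    have h1 := (NormedRing.inverse_continuousAt (1 : 𝔸ˣ)).tendsto
    simp only [Units.val_one, Ring.inverse_one] at h1
    exact h1.comp hg₁
  -- Near infinity the entire function `f₂⁻¹ f₁` equals `g₂ g₁⁻¹`, so Liouville's theorem applies.
  have hlim : Tendsto (fun z => Ring.inverse (f₂ z) * f₁ z) (cocompact ℂ) (𝓝 1) := by
    rw [← Metric.cobounded_eq_cocompact]
    have h2 := hg₂.mul hinv
    rw [one_mul] at h2
    refine h2.congr' ?_
    filter_upwards [h, hg₁.eventually (Units.isOpen.mem_nhds isUnit_one)] with z hz hu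
    rw [← Ring.mul_inverse_cancel_right (g₁ z) (f₁ z) hu, hz, ← mul_assoc, ← mul_assoc,
      Ring.inverse_mul_cancel _ (hu₂ z), one_mul]
  funext z
  have := hk.apply_eq_of_tendsto_cocompact z hlim
  have h3 : f₂ z * (Ring.inverse (f₂ z) * f₁ z) = f₂ z * 1 := congrArg _ this
  rwa [Ring.mul_inverse_cancel_left _ _ (hu₂ z), mul_one] at h3

end LoopDressing

/-! ### Dressing of a frame by a simple element -/

section FrameDressing
open Filter

/-- For a differential equation `f'` is a smooth expression in `f`, so each order of regularity of
`f` gives the next. -/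
theorem contDiffOn_infty_of_bootstrap {X Y : Type*} [NormedAddCommGroup X] [NormedSpace ℝ X]
    [NormedAddCommGroup Y] [NormedSpace ℝ Y] {f : X → Y} {f' : X → X →L[ℝ] Y} {V : Set X}
    (hV : IsOpen V) (hf : ∀ x ∈ V, HasFDerivAt f (f' x) x)
    (h : ∀ k : ℕ, ContDiffOn ℝ k f V → ContDiffOn ℝ k f' V) : ContDiffOn ℝ ∞ f V := by
  refine contDiffOn_infty.2 fun k => ?_
  induction k with
  | zero =>
    exact contDiffOn_zero.2 fun x hx => (hf x hx).continuousAt.continuousWithinAt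
  | succ k ih =>
    rw [Nat.cast_add, Nat.cast_one,
      contDiffOn_succ_iff_hasFDerivWithinAt_of_uniqueDiffOn hV.uniqueDiffOn]
    exact ⟨fun hk => by simp at hk, f', h k ih, fun x hx => (hf x hx).hasFDerivWithinAt⟩

variable {X 𝔸 : Type*} [NormedAddCommGroup X] [NormedSpace ℝ X]
  [NormedRing 𝔸] [NormedAlgebra ℂ 𝔸]

theorem contDiffOn_leftMul {g : X → 𝔸} {η : X → X →L[ℝ] 𝔸} {V : Set X} {k : WithTop ℕ∞}
    (hg : ContDiffOn ℝ k g V) (hη : ContDiffOn ℝ k η V) :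
    ContDiffOn ℝ k (fun x => leftMul (g x) (η x)) V :=
  ((ContinuousLinearMap.mul ℝ 𝔸).contDiff.comp_contDiffOn hg).clm_comp hη

theorem contDiffOn_frameForm (D : X →L[ℝ] 𝔸) {B : X → 𝔸} {V : Set X} {k : WithTop ℕ∞}
    (hB : ContDiffOn ℝ k B V) (z : ℂ) :
    ContDiffOn ℝ k (fun x => frameForm D (B x) z) V := by
  refine contDiffOn_const.add (ContDiffOn.sub ?_ ?_)
  · exact ((ContinuousLinearMap.mul ℝ 𝔸).flip.contDiff.comp_contDiffOn hB).clm_comp contDiffOn_const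
  · exact ((ContinuousLinearMap.mul ℝ 𝔸).contDiff.comp_contDiffOn hB).clm_comp contDiffOn_const

theorem contDiffOn_sandwich (D : X →L[ℝ] 𝔸) {g j : X → 𝔸} {V : Set X} {k : WithTop ℕ∞}
    (hg : ContDiffOn ℝ k g V) (hj : ContDiffOn ℝ k j V) :
    ContDiffOn ℝ k (fun x => sandwich (g x) D (j x)) V :=
  contDiffOn_leftMul hg
    (((ContinuousLinearMap.mul ℝ 𝔸).flip.contDiff.comp_contDiffOn hj).clm_comp contDiffOn_const)

theorem contDiffOn_ringInverse [CompleteSpace 𝔸] {g : X → 𝔸} {V : Set X} {k : WithTop ℕ∞}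
    (hg : ContDiffOn ℝ k g V) (hu : ∀ x ∈ V, IsUnit (g x)) :
    ContDiffOn ℝ k (fun x => Ring.inverse (g x)) V := by
  intro x hx
  obtain ⟨u, hu⟩ := hu x hx
  have h := contDiffAt_ringInverse (n := k) ℝ u
  rw [hu] at h
  exact h.comp_contDiffWithinAt x (hg x hx)

/-- The family `F` of positive loops is the frame of `B` on `V`, up to the initial condition. -/
structure IsHolomorphicFrame (D : X →L[ℝ] 𝔸) (B : X → 𝔸) (F : X → ℂ → 𝔸) (V : Set X) : Prop where
  smooth : ContDiffOn ℝ ∞ B V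
  solves : SolvesFrame D B F V Set.univ
  differentiable : ∀ x ∈ V, Differentiable ℂ (F x)
  isUnit : ∀ x ∈ V, ∀ z, IsUnit (F x z)

/-- The points of `V` at which the dressing with `1 + (z - a)⁻¹ N` is defined. -/
def dressingSet (a : ℂ) (N : 𝔸) (F : X → ℂ → 𝔸) (V : Set X) : Set X :=
  {x ∈ V | IsUnit (1 + N * logDerivAt (F x) a)}

namespace IsHolomorphicFrame

variable {D : X →L[ℝ] 𝔸} {B : X → 𝔸} {F : X → ℂ → 𝔸} {V : Set X}

theorem mono (hF : IsHolomorphicFrame D B F V) {W : Set X} (hW : W ⊆ V) :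
    IsHolomorphicFrame D B F W :=
  ⟨hF.smooth.mono hW, fun x hx => hF.solves x (hW hx), fun x hx => hF.differentiable x (hW hx),
    fun x hx => hF.isUnit x (hW hx)⟩

theorem congr (hF : IsHolomorphicFrame D B F V) (hV : IsOpen V) {G : X → ℂ → 𝔸}
    (h : ∀ x ∈ V, G x = F x) : IsHolomorphicFrame D B G V := by
  refine ⟨hF.smooth, fun x hx z hz => ?_, fun x hx => ?_, fun x hx z => ?_⟩
  · rw [h x hx]
    exact (hF.solves x hx z hz).congr_of_eventuallyEq
      (eventually_of_mem (hV.mem_nhds hx) fun y hy => congrFun (h y hy) z)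
  · rw [h x hx]
    exact hF.differentiable x hx
  · rw [h x hx]
    exact hF.isUnit x hx z

theorem contDiffOn (hF : IsHolomorphicFrame D B F V) (hV : IsOpen V) (z : ℂ) :
    ContDiffOn ℝ ∞ (fun x => F x z) V :=
  contDiffOn_infty_of_bootstrap hV (fun x hx => hF.solves x hx z trivial) fun _ hk =>
    contDiffOn_leftMul hk
      (contDiffOn_frameForm D (hF.smooth.of_le (by exact_mod_cast le_top)) z)

variable [ProperSpace X] [CompleteSpace 𝔸]

theorem hasFDerivAt_logDerivAt (hF : IsHolomorphicFrame D B F V) (hV : IsOpen V) (z : ℂ) {x : X}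
    (hx : x ∈ V) : HasFDerivAt (fun x => logDerivAt (F x) z)
      (sandwich (F x z) D (Ring.inverse (F x z))) x :=
  hF.solves.hasFDerivAt_logDerivAt hV hF.smooth.continuousOn (fun x hx => hF.isUnit x hx z)
    (fun x hx => hF.differentiable x hx z) hx

theorem contDiffOn_logDerivAt (hF : IsHolomorphicFrame D B F V) (hV : IsOpen V) (z : ℂ) :
    ContDiffOn ℝ ∞ (fun x => logDerivAt (F x) z) V :=
  contDiffOn_infty_of_bootstrap hV (fun _ hx => hF.hasFDerivAt_logDerivAt hV z hx) fun _ _ =>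
    (contDiffOn_sandwich D (hF.contDiffOn hV z)
      (contDiffOn_ringInverse (hF.contDiffOn hV z) fun x hx => hF.isUnit x hx z)).of_le
        (by exact_mod_cast le_top)

theorem isOpen_dressingSet (hF : IsHolomorphicFrame D B F V) (hV : IsOpen V) (a : ℂ) (N : 𝔸) :
    IsOpen (dressingSet a N F V) := by
  have h : ContinuousOn (fun x => 1 + N * logDerivAt (F x) a) V :=
    continuousOn_const.add (continuousOn_const.mul (hF.contDiffOn_logDerivAt hV a).continuousOn)
  exact h.isOpen_inter_preimage hV Units.isOpen

theorem contDiffOn_dressedElement (hF : IsHolomorphicFrame D B F V) (hV : IsOpen V) (a : ℂ)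
    (N : 𝔸) :
    ContDiffOn ℝ ∞ (fun x => dressedElement a N (F x)) (dressingSet a N F V) := by
  have hs : dressingSet a N F V ⊆ V := fun x hx => hx.1
  have h1 := (hF.contDiffOn hV a).mono hs
  have h2 := (hF.contDiffOn_logDerivAt hV a).mono hs
  exact ((contDiffOn_ringInverse h1 fun x hx => hF.isUnit x hx.1 a).mul
    ((contDiffOn_ringInverse (contDiffOn_const.add (contDiffOn_const.mul h2))
      fun x hx => hx.2).mul contDiffOn_const)).mul h1

/-- Conjugation by `F(x,a)` contributes the commutator of `Q` with the connection form at `a`. The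
factor `(1 + N F₁)⁻¹` contributes `-Q D Q`, because `dF₁ = F D F⁻¹`. -/
theorem hasFDerivAt_dressedElement (hF : IsHolomorphicFrame D B F V) (hV : IsOpen V) {a : ℂ}
    {N : 𝔸} {x : X} (hx : x ∈ dressingSet a N F V) :
    ∃ δ : X →L[ℝ] 𝔸, HasFDerivAt (fun x => dressedElement a N (F x)) δ x ∧
      ∀ v, δ v = dressedElement a N (F x) * frameForm D (B x) a v -
        frameForm D (B x) a v * dressedElement a N (F x) -
        dressedElement a N (F x) * D v * dressedElement a N (F x) := by
  have hf := hF.solves x hx.1 a trivial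
  have hi := hF.solves.hasFDerivAt_inverse hx.1 (Set.mem_univ a) (hF.isUnit x hx.1 a)
  have hl := hF.hasFDerivAt_logDerivAt hV a hx.1
  have hg : HasFDerivAt (𝕜 := ℝ) (fun x => 1 + N * logDerivAt (F x) a) _ x :=
    (hl.const_mul N).const_add 1
  have h2 := hasFDerivAt_ringInverse (𝕜 := ℝ) hx.2.unit
  rw [hx.2.unit_spec] at h2
  have hgi := h2.comp x hg
  refine ⟨_, (hi.mul' (hgi.mul_const' N)).mul' hf, fun v => ?_⟩
  have e1 := Ring.mul_inverse_cancel _ (hF.isUnit x hx.1 a)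
  have e2 := Ring.inverse_mul_cancel _ (hF.isUnit x hx.1 a)
  have e3 : (↑hx.2.unit⁻¹ : 𝔸) = Ring.inverse (1 + N * logDerivAt (F x) a) := by
    rw [← Ring.inverse_unit, hx.2.unit_spec]
  simp only [add_apply, neg_apply, smul_apply, ContinuousLinearMap.comp_apply,
    ContinuousLinearMap.flip_apply, ContinuousLinearMap.mul_apply',
    ContinuousLinearMap.mulLeftRight_apply, leftMul_apply, sandwich_apply, smul_eq_mul,
    MulOpposite.smul_eq_mul_unop, MulOpposite.unop_op, Pi.mul_apply,
    Function.comp_apply, dressedElement, e3]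
  generalize frameForm D (B x) a v = φ
  generalize D v = d
  generalize Ring.inverse (1 + N * logDerivAt (F x) a) = u
  generalize Ring.inverse (F x a) = j at *
  generalize F x a = g at *
  noncomm_ring

/-- Dressing a frame with a simple element gives a frame. -/
theorem dress (hF : IsHolomorphicFrame D B F V) (hV : IsOpen V) {a : ℂ} {N : 𝔸}
    (hN : N * N = 0) :
    IsHolomorphicFrame D (fun x => B x - dressedElement a N (F x))
      (fun x => dressedLoop a N (dressedElement a N (F x)) (F x)) (dressingSet a N F V) := by
  have hVo := hF.isOpen_dressingSet hV a N
  have hs : dressingSet a N F V ⊆ V := fun x hx => hx.1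
  have hsm : ContDiffOn ℝ ∞ (fun x => B x - dressedElement a N (F x)) (dressingSet a N F V) :=
    (hF.smooth.mono hs).sub (hF.contDiffOn_dressedElement hV a N)
  have hd : ∀ x ∈ dressingSet a N F V,
      Differentiable ℂ (dressedLoop a N (dressedElement a N (F x)) (F x)) := fun x hx =>
    differentiable_dressedLoop (hF.differentiable x hx.1)
  -- The product formula is singular at `z = a`, so the frame equation is checked for `z ≠ a` and
  -- extended over the removable value.
  refine ⟨hsm, SolvesFrame.of_compl_singleton (z₀ := a) ?_ hVo hsm.continuousOn
    fun x hx => (hd x hx).continuous.continuousAt, hd, fun x hx z =>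
      isUnit_dressedLoop hN (hF.differentiable x hx.1) (hF.isUnit x hx.1) hx.2 z⟩
  intro x hx z hz
  have hne : z - a ≠ 0 := sub_ne_zero.2 hz
  obtain ⟨δ, hδ, hδv⟩ := hF.hasFDerivAt_dressedElement hV hx
  have hprod : HasFDerivAt (fun x => (1 + (z - a)⁻¹ • N) * F x z *
      (1 - (z - a)⁻¹ • dressedElement a N (F x))) _ x :=
    ((hF.solves x hx.1 z trivial).const_mul (1 + (z - a)⁻¹ • N)).mul'
      ((hδ.const_smul (z - a)⁻¹).const_sub 1)
  have heq : ∀ x ∈ dressingSet a N F V, dressedLoop a N (dressedElement a N (F x)) (F x) z =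
      (1 + (z - a)⁻¹ • N) * F x z * (1 - (z - a)⁻¹ • dressedElement a N (F x)) := fun x hx =>
    dressedLoop_dressedElement hN (hF.isUnit x hx.1 a) hx.2 hz
  refine HasFDerivAt.congr_of_eventuallyEq (HasFDerivAt.congr_fderiv hprod ?_)
    (eventually_of_mem (hVo.mem_nhds hx) heq)
  obtain ⟨-, -, hQ, -⟩ := dressedElement_relations hN (hF.isUnit x hx.1 a) hx.2
  ext v
  have hform : ∀ b, frameForm D b z v = frameForm D b a v + (z - a) • D v := fun b => by
    simp only [frameForm_apply, sub_smul]; abel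
  have hform' : ∀ b c, frameForm D (b - c) a v = frameForm D b a v - (D v * c - c * D v) :=
    fun b c => by
      simp only [frameForm_apply, mul_sub, sub_mul]; abel
  simp only [add_apply, neg_apply, smul_apply, leftMul_apply, smul_eq_mul,
    MulOpposite.smul_eq_mul_unop, MulOpposite.unop_op, heq x hx, hδv, hform, hform']
  generalize dressedElement a N (F x) = Q at *
  generalize frameForm D (B x) a v = φ
  generalize D v = d
  generalize F x z = g
  have hc : (z - a)⁻¹ * (z - a) = 1 := inv_mul_cancel₀ hne
  generalize (z - a)⁻¹ = c at *
  generalize z - a = ζ at *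
  have hQ1 : ∀ y, Q * (Q * y) = 0 := fun y => by rw [← mul_assoc, hQ, zero_mul]
  -- The gauge transformation by `1 - cQ`: with the Riccati equation, `Q² = 0` and `cζ = 1`, all
  -- terms in `c` match and only the change of `B` by `-Q` remains.
  have key : -(c • (Q * φ - φ * Q - Q * d * Q)) + (φ + ζ • d) * (1 - c • Q) =
      (1 - c • Q) * (φ - (d * Q - Q * d) + ζ • d) := by
    simp only [add_mul, mul_add, sub_mul, mul_sub, one_mul, mul_one, smul_mul_assoc,
      mul_smul_comm, smul_sub, smul_add, smul_smul, mul_assoc, hQ1, hc]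
    rw [mul_comm ζ c, hc]
    simp only [one_smul, smul_zero]
    abel
  calc _ = (1 + c • N) * g * (-(c • (Q * φ - φ * Q - Q * d * Q)) + (φ + ζ • d) * (1 - c • Q)) := by
        rw [mul_add ((1 + c • N) * g)]
        simp only [mul_assoc]
    _ = _ := by rw [key]; simp only [mul_assoc]

end IsHolomorphicFrame
end FrameDressing

/-! ### Derivatives read off from coordinates -/

section Coordinates

variable {X 𝔸 : Type*} [NormedAddCommGroup X] [NormedSpace ℝ X]
  [NormedRing 𝔸] [NormedAlgebra ℂ 𝔸]

/-- The values of `𝔸`-valued one-forms on `X`, for the real structure that underlies the complex one. -/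
abbrev OneForm (X 𝔸 : Type*) [NormedAddCommGroup X] [NormedSpace ℝ X] [NormedRing 𝔸]
    [NormedAlgebra ℂ 𝔸] : Type _ := X →L[ℝ] 𝔸

/-- The one-form `∑ eᵢ dxᵢ`. -/
def coordForm {ι : Type*} [Fintype ι] (e : ι → 𝔸) : OneForm (ι → ℝ) 𝔸 :=
  ∑ i, (ContinuousLinearMap.proj i : (ι → ℝ) →L[ℝ] ℝ).smulRight (e i)

theorem coordForm_apply {ι : Type*} [Fintype ι] (e : ι → 𝔸) (v : ι → ℝ) :
    coordForm e v = ∑ i, (v i : ℂ) • e i := by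
  simp [coordForm]

theorem coordForm_single {ι : Type*} [Fintype ι] [DecidableEq ι] (e : ι → 𝔸) (i : ι) :
    coordForm e (Pi.single i 1) = e i := by
  rw [coordForm_apply, Finset.sum_eq_single i] <;> simp +contextual

theorem hasFDerivAt_of_coordinates {κ : Type*} [Fintype κ] (e : κ → 𝔸 →L[ℂ] ℂ) (b : κ → 𝔸)
    (hb : ∀ a, ∑ k, e k a • b k = a) {F : X → 𝔸} {F' : OneForm X 𝔸} {x : X} {G : κ → X →L[ℝ] ℂ}
    (h : ∀ k, HasFDerivAt (fun y => e k (F y)) (G k) x) (hG : ∀ k v, e k (F' v) = G k v) :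
    HasFDerivAt F F' x := by
  have h1 : HasFDerivAt (fun y => ∑ k, e k (F y) • b k) _ x :=
    HasFDerivAt.fun_sum fun k _ => (h k).smul_const (b k)
  simp only [hb] at h1
  refine h1.congr_fderiv ?_
  ext v
  rw [← hb (F' v)]
  simp [hG]

theorem hasFDerivAt_coordinate (e : 𝔸 →L[ℂ] ℂ) {F : X → 𝔸} {F' : OneForm X 𝔸} {x : X}
    (h : HasFDerivAt F F' x) :
    ∃ G : X →L[ℝ] ℂ, HasFDerivAt (fun y => e (F y)) G x ∧ ∀ v, G v = e (F' v) :=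
  ⟨_, (e.restrictScalars ℝ).hasFDerivAt.comp x h, fun _ => rfl⟩

end Coordinates

/-! ### Passage between entrywise matrix calculus and the Banach algebra -/

section MatrixCalculus
open Filter

variable {n : ℕ}

attribute [local instance] Matrix.linftyOpNormedRing

local instance matrixNormedAlgebra : NormedAlgebra ℂ (Matrix (Fin n) (Fin n) ℂ) :=
  Matrix.linftyOpNormedAlgebra

/-- An entry of a matrix, as a continuous linear function. -/
def entryCLM (j k : Fin n) : Matrix (Fin n) (Fin n) ℂ →L[ℂ] ℂ :=
  LinearMap.toContinuousLinearMap (Matrix.entryLinearMap ℂ ℂ j k)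

local instance matrixCompleteSpace : CompleteSpace (Matrix (Fin n) (Fin n) ℂ) :=
  FiniteDimensional.complete ℂ _

theorem sum_entry_smul_single (M : Matrix (Fin n) (Fin n) ℂ) :
    ∑ j, ∑ k, M j k • Matrix.single j k (1 : ℂ) = M := by
  conv_rhs => rw [Matrix.matrix_eq_sum_single M]
  simp

variable {X : Type*} [NormedAddCommGroup X] [NormedSpace ℝ X]

theorem hasFDerivAt_entry {F : X → Matrix (Fin n) (Fin n) ℂ}
    {F' : OneForm X (Matrix (Fin n) (Fin n) ℂ)} {x : X} (h : HasFDerivAt F F' x) (j k : Fin n) :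
    ∃ G : X →L[ℝ] ℂ, HasFDerivAt (fun y => F y j k) G x ∧ ∀ v, G v = F' v j k :=
  hasFDerivAt_coordinate (entryCLM j k) h

theorem hasFDerivAt_of_entry {F : X → Matrix (Fin n) (Fin n) ℂ}
    {F' : OneForm X (Matrix (Fin n) (Fin n) ℂ)} {x : X} {G : Fin n → Fin n → X →L[ℝ] ℂ}
    (h : ∀ j k, HasFDerivAt (fun y => F y j k) (G j k) x) (hG : ∀ j k v, F' v j k = G j k v) :
    HasFDerivAt F F' x :=
  hasFDerivAt_of_coordinates (κ := Fin n × Fin n) (fun q => entryCLM q.1 q.2)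
    (fun q => Matrix.single q.1 q.2 1)
    (fun M => (Fintype.sum_prod_type _).trans (sum_entry_smul_single M))
    (G := fun q => G q.1 q.2) (fun q => h q.1 q.2) (fun q => hG q.1 q.2)

theorem contDiffOn_entry {F : X → Matrix (Fin n) (Fin n) ℂ} {V : Set X} {k : WithTop ℕ∞}
    (h : ContDiffOn ℝ k F V) (i j : Fin n) : ContDiffOn ℝ k (fun x => F x i j) V :=
  ((entryCLM i j).restrictScalars ℝ).contDiff.comp_contDiffOn h

theorem contDiffOn_of_entry {F : X → Matrix (Fin n) (Fin n) ℂ} {V : Set X} {k : WithTop ℕ∞}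
    (h : ∀ i j, ContDiffOn ℝ k (fun x => F x i j) V) : ContDiffOn ℝ k F V := by
  have h1 : ContDiffOn ℝ k (fun y => ∑ i, ∑ j, F y i j • Matrix.single i j (1 : ℂ)) V :=
    ContDiffOn.sum fun i _ => ContDiffOn.sum fun j _ => (h i j).smul contDiffOn_const
  simpa only [sum_entry_smul_single] using h1

theorem differentiable_matrix_iff {f : ℂ → Matrix (Fin n) (Fin n) ℂ} :
    Differentiable ℂ f ↔ ∀ i j, Differentiable ℂ fun z => f z i j := by
  refine ⟨fun h i j => (entryCLM i j).differentiable.comp h, fun h => ?_⟩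
  have h1 : Differentiable ℂ (fun y => ∑ i, ∑ j, f y i j • Matrix.single i j (1 : ℂ)) :=
    Differentiable.fun_sum fun i _ => Differentiable.fun_sum fun j _ => (h i j).smul_const _
  simpa only [sum_entry_smul_single] using h1

theorem logDerivAt_eq_normalizedDeriv {f : ℂ → Matrix (Fin n) (Fin n) ℂ} {a : ℂ}
    (hf : DifferentiableAt ℂ f a) : normalizedDeriv f a = logDerivAt f a := by
  ext j k
  have h1 := (entryCLM j k).hasFDerivAt.comp_hasDerivAt a (hasDerivAt_mul_inverse hf)
  rw [normalizedDeriv, Matrix.of_apply]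
  simp only [Matrix.nonsing_inv_eq_ringInverse]
  exact h1.deriv

/-- The diagonal matrix valued one-form `∑ aᵢ dxᵢ`. -/
def diagForm (n : ℕ) : OneForm (Fin n → ℝ) (Matrix (Fin n) (Fin n) ℂ) :=
  coordForm fun i => Matrix.single i i 1

theorem diagForm_single (i : Fin n) : diagForm n (Pi.single i 1) = Matrix.single i i 1 :=
  coordForm_single _ i

theorem dressedNilpotent_eq_dressedElement {f : ℂ → Matrix (Fin n) (Fin n) ℂ} {a : ℂ}
    (N : Matrix (Fin n) (Fin n) ℂ) (hf : DifferentiableAt ℂ f a) :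
    dressedNilpotent a N f = dressedElement a N f := by
  simp only [dressedNilpotent, dressedElement, logDerivAt_eq_normalizedDeriv hf,
    Matrix.nonsing_inv_eq_ringInverse, mul_assoc]

theorem frameForm_diagForm_single (β : Matrix (Fin n) (Fin n) ℝ) (z : ℂ) (i : Fin n) :
    frameForm (diagForm n) (β.map Complex.ofReal) z (Pi.single i 1) = connectionCoeff β i z := by
  rw [frameForm_apply, diagForm_single, connectionCoeff]

/-- The coordinate equations determine the derivative, since a linear map is fixed by its values on
the basis. Holomorphy in `z` spreads over the connected `U` from `0`, where `E` is constant in `z`.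
-/
theorem isHolomorphicFrame_of_isFrame {β : (Fin n → ℝ) → Matrix (Fin n) (Fin n) ℝ}
    {E : (Fin n → ℝ) → ℂ → Matrix (Fin n) (Fin n) ℂ} {U : Set (Fin n → ℝ)} (hU : IsOpen U)
    (hUc : IsPreconnected U) (h0 : (0 : Fin n → ℝ) ∈ U)
    (hβ : ∀ i j, ContDiffOn ℝ ∞ (fun x => β x i j) U) (hE : IsFrame β E U) :
    IsHolomorphicFrame (diagForm n) (fun x => (β x).map Complex.ofReal) E U := by
  have hsm : ContDiffOn ℝ ∞ (fun x => (β x).map Complex.ofReal) U :=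
    contDiffOn_of_entry fun i j => Complex.ofRealCLM.contDiff.comp_contDiffOn (hβ i j)
  have hs : SolvesFrame (diagForm n) (fun x => (β x).map Complex.ofReal) E U Set.univ := by
    intro x hx z _
    have hd : ∀ j k, HasFDerivAt (fun y => E y z j k) (fderiv ℝ (fun y => E y z j k) x) x :=
      fun j k => (((hE.smooth z j k).contDiffAt (hU.mem_nhds hx)).differentiableAt
        (by simp)).hasFDerivAt
    refine hasFDerivAt_of_entry hd fun j k v => ?_
    set G : OneForm (Fin n → ℝ) (Matrix (Fin n) (Fin n) ℂ) :=
      leftMul (E x z) (frameForm (diagForm n) ((β x).map Complex.ofReal) z) with hG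
    have h1 : (((entryCLM j k).restrictScalars ℝ).comp G : (Fin n → ℝ) →L[ℝ] ℂ).toLinearMap =
        (fderiv ℝ (fun y => E y z j k) x).toLinearMap := by
      refine (Pi.basisFun ℝ (Fin n)).ext fun i => ?_
      have h2 : pderivMatrix (fun y => E y z) i x = E x z * connectionCoeff (β x) i z := by
        rw [← hE.deriv_eq x hx z i, Matrix.mul_nonsing_inv_cancel_left]
        exact (Matrix.isUnit_iff_isUnit_det _).1 (hE.isUnit x hx z)
      rw [Pi.basisFun_apply]
      change (E x z * frameForm (diagForm n) ((β x).map Complex.ofReal) z (Pi.single i 1)) j k =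
        pderivMatrix (fun y => E y z) i x j k
      rw [h2, frameForm_diagForm_single]
    exact DFunLike.congr_fun h1 v
  refine ⟨hsm, hs, fun x hx z => ?_, hE.isUnit⟩
  refine hs.differentiableAt hU hUc hsm.continuousOn (fun x hx => hE.isUnit x hx z) h0 ?_ hx
  simp only [show E 0 = fun _ => 1 from funext hE.initial]
  exact differentiableAt_const _

end MatrixCalculus

/-! ### The twisted element `s` and the loop it dresses -/

section TwistedLoops
open Filter

variable {n : ℕ}

attribute [local instance] Matrix.linftyOpNormedRing matrixNormedAlgebra matrixCompleteSpace

theorem simpleElement_inv {a z : ℂ} {Q : Matrix (Fin n) (Fin n) ℂ} (hQ : Q * Q = 0) :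
    (simpleElement a Q z)⁻¹ = 1 - (z - a)⁻¹ • Q :=
  Matrix.inv_eq_right_inv (one_add_smul_mul_one_sub_smul hQ _)

/-- Over `ℝ` this is the identity plus a positive semidefinite matrix, hence positive definite;
invertibility survives the passage to `ℂ`. -/
theorem isUnit_one_add_smul_transpose_mul_self (N : Matrix (Fin n) (Fin n) ℝ) {α : ℝ} :
    IsUnit (1 + (1 / (4 * (α : ℂ) ^ 2)) •
      ((N.map Complex.ofReal)ᵀ * N.map Complex.ofReal)) := by
  have h1 : (1 + (1 / (4 * α ^ 2)) • (Nᵀ * N)).PosDef := by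
    refine Matrix.PosDef.one.add_posSemidef (Matrix.PosSemidef.smul ?_ (by positivity))
    simpa using Matrix.posSemidef_conjTranspose_mul_self N
  have h2 := h1.isUnit.map (Complex.ofRealHom.mapMatrix (m := Fin n))
  have h3 : Complex.ofRealHom.mapMatrix (1 + (1 / (4 * α ^ 2)) • (Nᵀ * N)) =
      1 + (1 / (4 * (α : ℂ) ^ 2)) • ((N.map Complex.ofReal)ᵀ * N.map Complex.ofReal) := by
    rw [map_add, map_one]
    congr 1
    ext i j
    simp [Matrix.mul_apply]
  rwa [h3] at h2

/-- With `G` the inverse in the definition of `N'`, nilpotency gives `G N = N` and `Nᵗ G = Nᵗ`,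
which collapse the products. The second relation and its transpose are what the twisting condition
on `s` requires at its two poles. -/
theorem twistPartner_relations {a : ℂ} {N : Matrix (Fin n) (Fin n) ℂ} (hN : N * N = 0)
    (hu : IsUnit (1 + (1 / (4 * a ^ 2)) • (Nᵀ * N))) :
    twistPartner a N * twistPartner a N = 0 ∧
      twistPartner a N + (1 / (2 * a)) • ((twistPartner a N)ᵀ * twistPartner a N) =
        Nᵀ + (1 / (2 * a)) • (Nᵀ * N) := by
  have hT : Nᵀ * Nᵀ = 0 := by rw [← Matrix.transpose_mul, hN, Matrix.transpose_zero]
  have hk : 1 / (4 * a ^ 2) = (1 / (2 * a)) * (1 / (2 * a)) := by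
    rw [one_div_mul_one_div]; ring_nf
  have hsymm : ((1 + (1 / (4 * a ^ 2)) • (Nᵀ * N))⁻¹)ᵀ = (1 + (1 / (4 * a ^ 2)) • (Nᵀ * N))⁻¹ := by
    rw [Matrix.transpose_nonsing_inv]
    simp [Matrix.transpose_mul]
  have hdet := (Matrix.isUnit_iff_isUnit_det _).1 hu
  have hG1 := Matrix.mul_nonsing_inv _ hdet
  have hG2 := Matrix.nonsing_inv_mul _ hdet
  have hPT : (twistPartner a N)ᵀ = (1 + (1 / (2 * a)) • Nᵀ) * N *
      (1 + (1 / (4 * a ^ 2)) • (Nᵀ * N))⁻¹ * (1 - (1 / (2 * a)) • Nᵀ) := by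
    rw [twistPartner]
    simp only [Matrix.transpose_mul, Matrix.transpose_add, Matrix.transpose_sub,
      Matrix.transpose_smul, Matrix.transpose_one, Matrix.transpose_transpose, hsymm, mul_assoc]
  rw [hPT, twistPartner]
  generalize (1 + (1 / (4 * a ^ 2)) • (Nᵀ * N))⁻¹ = G at *
  rw [hk] at hG1 hG2
  clear hPT hsymm hu hdet
  generalize 1 / (2 * a) = k at *
  generalize Nᵀ = T at *
  have hGN : G * N = N := by
    calc G * N = G * ((1 + (k * k) • (T * N)) * N) := by
          rw [add_mul, smul_mul_assoc, mul_assoc T, hN]; simp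
      _ = N := by rw [← mul_assoc, hG2, one_mul]
  have hTG : T * G = T := by
    calc T * G = (T * (1 + (k * k) • (T * N))) * G := by
          rw [mul_add, mul_smul_comm, ← mul_assoc T, hT]; simp
      _ = T := by rw [mul_assoc, hG1, mul_one]
  have hcancel : (1 + k • N) * (1 - k • N) = 1 := one_add_smul_mul_one_sub_smul hN k
  constructor
  · calc (1 - k • N) * G * T * (1 + k • N) * ((1 - k • N) * G * T * (1 + k • N))
        = (1 - k • N) * G * T * ((1 + k • N) * (1 - k • N)) * G * T * (1 + k • N) := by
          simp only [mul_assoc]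
      _ = (1 - k • N) * G * (T * G * T) * (1 + k • N) := by
          rw [hcancel, mul_one]; simp only [mul_assoc]
      _ = 0 := by rw [hTG, hT]; simp
  · have hmid : N * G * ((1 - k • T) * (1 - k • N)) * G * T = N * G * T := by
      have h1 : (1 - k • T) * (1 - k • N) = (1 + (k * k) • (T * N)) - k • T - k • N := by
        simp only [sub_mul, mul_sub, one_mul, mul_one, smul_mul_smul_comm]; abel
      calc N * G * ((1 - k • T) * (1 - k • N)) * G * T
          = N * G * ((1 + (k * k) • (T * N)) * G) * T - k • (N * G * (T * G * T)) -
              k • (N * (G * N) * G * T) := by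
            rw [h1]
            simp only [mul_sub, sub_mul, mul_smul_comm, smul_mul_assoc, mul_assoc]
        _ = N * G * T := by rw [hG1, hTG, hT, hGN, hN]; simp
    calc (1 - k • N) * G * T * (1 + k • N) + k • ((1 + k • T) * N * G * (1 - k • T) *
          ((1 - k • N) * G * T * (1 + k • N)))
        = (1 - k • N) * G * T * (1 + k • N) +
          k • ((1 + k • T) * (N * G * ((1 - k • T) * (1 - k • N)) * G * T) * (1 + k • N)) := by
          simp only [mul_assoc]
      _ = (((1 + (k * k) • (T * N)) * G) * T) * (1 + k • N) := by
          rw [hmid]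
          simp only [add_mul, sub_mul, one_mul, smul_mul_assoc, mul_assoc, smul_add, smul_smul]
          abel
      _ = T + k • (T * N) := by rw [hG1, one_mul, mul_add, mul_one, mul_smul_comm]

/-- It suffices to show that the two middle factors, built from `N'`, multiply to the inverse of the
outer ones. Partial fractions reduce this to the relation for `N'` and its transpose. -/
theorem twistedElement_twist {a : ℂ} {N : Matrix (Fin n) (Fin n) ℂ} (ha : a ≠ 0) (hN : N * N = 0)
    (hu : IsUnit (1 + (1 / (4 * a ^ 2)) • (Nᵀ * N))) {z : ℂ} (hz : z ≠ a) (hz' : z ≠ -a) :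
    (twistedElement a N (-z))ᵀ * twistedElement a N z = 1 := by
  obtain ⟨-, hrel⟩ := twistPartner_relations hN hu
  have hT : Nᵀ * Nᵀ = 0 := by rw [← Matrix.transpose_mul, hN, Matrix.transpose_zero]
  have hrel' := congrArg Matrix.transpose hrel
  simp only [Matrix.transpose_add, Matrix.transpose_smul, Matrix.transpose_mul,
    Matrix.transpose_transpose] at hrel'
  simp only [twistedElement, simpleElement]
  have e1 : (-z - -a)⁻¹ = -(z - a)⁻¹ := by rw [← inv_neg]; ring_nf
  have e2 : (-z - a)⁻¹ = -(z + a)⁻¹ := by rw [← inv_neg]; ring_nf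
  have h1 : z - a ≠ 0 := sub_ne_zero.2 hz
  have h2 : z + a ≠ 0 := fun h => hz' (eq_neg_of_add_eq_zero_left h)
  have huv : (z - a)⁻¹ * (z + a)⁻¹ = (1 / (2 * a)) * ((z - a)⁻¹ - (z + a)⁻¹) := by
    field_simp
    ring
  rw [e1, e2, sub_neg_eq_add]
  generalize twistPartner a N = P at *
  generalize (z - a)⁻¹ = u at *
  generalize (z + a)⁻¹ = v at *
  generalize 1 / (2 * a) = k at *
  simp only [Matrix.transpose_add, Matrix.transpose_smul, Matrix.transpose_mul,
    Matrix.transpose_one]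
  have key : (1 + -u • Pᵀ) * (1 + v • P) = (1 + v • Nᵀ) * (1 - u • N) := by
    have h3 : (1 + -u • Pᵀ) * (1 + v • P) =
        1 - u • (Pᵀ + k • (Pᵀ * P)) + v • (P + k • (Pᵀ * P)) := by
      simp only [add_mul, mul_add, one_mul, mul_one, smul_mul_smul_comm, neg_mul, huv]
      module
    rw [h3, hrel, hrel']
    simp only [add_mul, mul_sub, one_mul, mul_one, smul_mul_smul_comm, mul_comm v u, huv]
    module
  calc (1 + -v • Nᵀ) * (1 + -u • Pᵀ) * ((1 + v • P) * (1 + u • N))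
      = (1 + -v • Nᵀ) * ((1 + -u • Pᵀ) * (1 + v • P)) * (1 + u • N) := by simp only [mul_assoc]
    _ = ((1 - v • Nᵀ) * (1 + v • Nᵀ)) * ((1 - u • N) * (1 + u • N)) := by
        rw [key, neg_smul, ← sub_eq_add_neg]; simp only [mul_assoc]
    _ = 1 := by
        rw [one_sub_smul_mul_one_add_smul hT, one_sub_smul_mul_one_add_smul hN, one_mul]

theorem tendsto_simpleElement (a : ℂ) (N : Matrix (Fin n) (Fin n) ℂ) :
    Tendsto (simpleElement a N) (Bornology.cobounded ℂ) (𝓝 1) := by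
  have h1 : Tendsto (fun z : ℂ => (z - a)⁻¹) (Bornology.cobounded ℂ) (𝓝 0) :=
    tendsto_inv₀_cobounded.comp (by simp [sub_eq_add_neg])
  have h2 := (h1.smul_const N).const_add 1
  rw [zero_smul, add_zero] at h2
  exact h2

theorem isNegativeLoop_simpleElement_mul (a b : ℂ) (M N : Matrix (Fin n) (Fin n) ℂ) :
    IsNegativeLoop fun z => simpleElement b M z * simpleElement a N z := by
  open Polynomial in
  refine ⟨fun i j => ⟨C ((1 : Matrix (Fin n) (Fin n) ℂ) i j) * ((X - C a) * (X - C b)) +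
    C (M i j) * (X - C a) + C (N i j) * (X - C b) + C ((M * N) i j), (X - C a) * (X - C b),
    mul_ne_zero (X_sub_C_ne_zero a) (X_sub_C_ne_zero b), fun z hz => ?_⟩, ?_⟩
  · simp only [eval_mul, eval_sub, eval_X, eval_C, ne_eq, mul_eq_zero, not_or] at hz
    obtain ⟨ha, hb⟩ := hz
    simp only [simpleElement, add_mul, mul_add, one_mul, mul_one, smul_mul_smul_comm,
      Matrix.add_apply, Matrix.smul_apply, smul_eq_mul, eval_add, eval_mul, eval_sub, eval_X,
      eval_C]
    field_simp
    ring
  · have := (tendsto_simpleElement b M).mul (tendsto_simpleElement a N)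
    rwa [one_mul] at this

theorem normalizedDeriv_congr {f g : ℂ → Matrix (Fin n) (Fin n) ℂ} {a : ℂ} (h : f =ᶠ[𝓝 a] g) :
    normalizedDeriv f a = normalizedDeriv g a := by
  ext j k
  rw [normalizedDeriv, normalizedDeriv, Matrix.of_apply, Matrix.of_apply, h.eq_of_nhds]
  refine EventuallyEq.deriv_eq ?_
  filter_upwards [h] with z hz
  rw [hz]

theorem dressedNilpotent_congr {f g : ℂ → Matrix (Fin n) (Fin n) ℂ} {a : ℂ}
    (N : Matrix (Fin n) (Fin n) ℂ) (h : f =ᶠ[𝓝 a] g) :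
    dressedNilpotent a N f = dressedNilpotent a N g := by
  rw [dressedNilpotent, dressedNilpotent, normalizedDeriv_congr h, h.eq_of_nhds]

section Dressed

variable {a : ℂ} {N : Matrix (Fin n) (Fin n) ℂ} {f : ℂ → Matrix (Fin n) (Fin n) ℂ}

/-- The positive loop `m_{a,1,N} f m_{a,1,Ñ}⁻¹`. -/
def dressedOnceLoop (a : ℂ) (N : Matrix (Fin n) (Fin n) ℂ) (f : ℂ → Matrix (Fin n) (Fin n) ℂ) :
    ℂ → Matrix (Fin n) (Fin n) ℂ :=
  dressedLoop a N (dressedElement a N f) f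

theorem dressOnce_eq (hN : N * N = 0) (hf : Differentiable ℂ f) (hu : ∀ z, IsUnit (f z))
    (h1 : IsUnit (1 + N * logDerivAt f a)) {z : ℂ} (hz : z ≠ a) :
    dressOnce a N f z = dressedOnceLoop a N f z := by
  rw [dressedOnceLoop, dressedLoop_dressedElement hN (hu a) h1 hz, dressOnce,
    dressedNilpotent_eq_dressedElement N (hf a),
    simpleElement_inv (dressedElement_relations hN (hu a) h1).2.2.1, simpleElement]

/-- The explicit formula has a meaningless value at `a`, but `-a ≠ a`, so the second dressing, at
`-a`, sees only the holomorphic loop. -/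
theorem dressOnce_eventuallyEq (hN : N * N = 0) (hf : Differentiable ℂ f)
    (hu : ∀ z, IsUnit (f z)) (h1 : IsUnit (1 + N * logDerivAt f a)) (ha : a ≠ 0) :
    dressOnce a N f =ᶠ[𝓝 (-a)] dressedOnceLoop a N f := by
  have hne : -a ≠ a := fun h => ha (by linear_combination (-1 / 2 : ℂ) * h)
  filter_upwards [isOpen_compl_singleton.mem_nhds hne] with z hz
  exact dressOnce_eq hN hf hu h1 hz

theorem dressingDefined_iff (hN : N * N = 0) (hf : Differentiable ℂ f)
    (hu : ∀ z, IsUnit (f z)) (ha : a ≠ 0) :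
    DressingDefined a N f ↔ IsUnit (1 + N * logDerivAt f a) ∧
      IsUnit (1 + twistPartner a N * logDerivAt (dressedOnceLoop a N f) (-a)) := by
  rw [DressingDefined, logDerivAt_eq_normalizedDeriv (hf a)]
  refine and_congr_right fun h1 => ?_
  rw [normalizedDeriv_congr (dressOnce_eventuallyEq hN hf hu h1 ha),
    logDerivAt_eq_normalizedDeriv (f := dressedOnceLoop a N f) (differentiable_dressedLoop hf _)]

/-- The positive loop obtained by dressing `f` with `s_{a,N}`. -/
def dressedTwiceLoop (a : ℂ) (N : Matrix (Fin n) (Fin n) ℂ) (f : ℂ → Matrix (Fin n) (Fin n) ℂ) :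
    ℂ → Matrix (Fin n) (Fin n) ℂ :=
  dressedOnceLoop (-a) (twistPartner a N) (dressedOnceLoop a N f)

variable (ha : a ≠ 0) (hN : N * N = 0) (hP : twistPartner a N * twistPartner a N = 0)
  (hf : Differentiable ℂ f) (hu : ∀ z, IsUnit (f z)) (hdef : DressingDefined a N f)

include ha hN hP hf hu hdef

theorem dressed_formula {z : ℂ} (hz : z ≠ a) (hz' : z ≠ -a) :
    twistedElement a N z * f z * (simpleElement a (dressedNilpotent a N f) z)⁻¹ *
      (simpleElement (-a) (dressedNilpotent (-a) (twistPartner a N) (dressOnce a N f)) z)⁻¹ =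
    dressedTwiceLoop a N f z := by
  obtain ⟨h1, h2⟩ := (dressingDefined_iff hN hf hu ha).1 hdef
  have hd : Differentiable ℂ (dressedOnceLoop a N f) := differentiable_dressedLoop hf
  have hu1 : ∀ z, IsUnit (dressedOnceLoop a N f z) := isUnit_dressedLoop hN hf hu h1
  rw [dressedTwiceLoop, ← dressOnce_eq hP hd hu1 h2 hz', dressOnce,
    dressedNilpotent_congr _ (dressOnce_eventuallyEq hN hf hu h1 ha), ← dressOnce_eq hN hf hu h1 hz,
    dressOnce, twistedElement]
  simp only [mul_assoc]

theorem dressed_eq : dressed a N f = dressedTwiceLoop a N f := by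
  obtain ⟨h1, h2⟩ := (dressingDefined_iff hN hf hu ha).1 hdef
  have hd : Differentiable ℂ (dressedTwiceLoop a N f) :=
    differentiable_dressedLoop (differentiable_dressedLoop hf)
  funext z
  refine Tendsto.limUnder_eq ?_
  refine ((hd z).continuousAt.tendsto.mono_left nhdsWithin_le_nhds).congr' ?_
  have hfin : ({a, -a} : Set ℂ).Finite := Set.toFinite _
  -- If `z` is itself a singularity, the punctured filter already excludes it; only the others have
  -- to be avoided.
  have hmem : ({a, -a} \ {z} : Set ℂ)ᶜ ∈ 𝓝 z :=
    (hfin.subset Set.sdiff_subset).isClosed.isOpen_compl.mem_nhds (by simp)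
  filter_upwards [self_mem_nhdsWithin, nhdsWithin_le_nhds hmem] with w hw hw'
  have hwz : w ≠ z := hw
  have hw2 : w ≠ a ∧ w ≠ -a := by
    simpa [hwz, not_or] using hw'
  exact (dressed_formula ha hN hP hf hu hdef hw2.1 hw2.2).symm

theorem isUnit_dressedTwiceLoop (z : ℂ) : IsUnit (dressedTwiceLoop a N f z) := by
  obtain ⟨h1, h2⟩ := (dressingDefined_iff hN hf hu ha).1 hdef
  exact isUnit_dressedLoop hP (differentiable_dressedLoop hf) (isUnit_dressedLoop hN hf hu h1) h2 z

/-- The factorization `s f = fhat ghat` with a negative loop `ghat`. -/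
theorem exists_dressed_factorization :
    ∃ ghat : ℂ → Matrix (Fin n) (Fin n) ℂ, IsNegativeLoop ghat ∧
      ∀ z, z ≠ a → z ≠ -a → twistedElement a N z * f z = dressedTwiceLoop a N f z * ghat z := by
  obtain ⟨h1, h2⟩ := (dressingDefined_iff hN hf hu ha).1 hdef
  have hd : Differentiable ℂ (dressedOnceLoop a N f) := differentiable_dressedLoop hf
  have hu1 : ∀ z, IsUnit (dressedOnceLoop a N f z) := isUnit_dressedLoop hN hf hu h1
  refine ⟨_, isNegativeLoop_simpleElement_mul a (-a)
    (dressedElement (-a) (twistPartner a N) (dressedOnceLoop a N f)) (dressedElement a N f),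
    fun z hz hz' => ?_⟩
  have r1 := (dressedElement_relations hN (hu a) h1).2.2.1
  have r2 := (dressedElement_relations hP (hu1 (-a)) h2).2.2.1
  rw [← dressed_formula ha hN hP hf hu hdef hz hz',
    dressedNilpotent_congr _ (dressOnce_eventuallyEq hN hf hu h1 ha),
    dressedNilpotent_eq_dressedElement N (hf a), dressedNilpotent_eq_dressedElement _ (hd (-a)),
    simpleElement_inv r1, simpleElement_inv r2, simpleElement, simpleElement]
  set Q := dressedElement a N f
  set Q' := dressedElement (-a) (twistPartner a N) (dressedOnceLoop a N f)
  calc _ = twistedElement a N z * f z * ((1 - (z - a)⁻¹ • Q) * (1 + (z - a)⁻¹ • Q)) := by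
        rw [one_sub_smul_mul_one_add_smul r1, mul_one]
    _ = twistedElement a N z * f z * ((1 - (z - a)⁻¹ • Q) *
          ((1 - (z - -a)⁻¹ • Q') * (1 + (z - -a)⁻¹ • Q')) * (1 + (z - a)⁻¹ • Q)) := by
        rw [one_sub_smul_mul_one_add_smul r2, mul_one]
    _ = _ := by simp only [mul_assoc]

theorem isDressing_dressed (hf' : IsPositiveLoop f) :
    IsDressing (twistedElement a N) f (dressed a N f) := by
  obtain ⟨g, hg, hgf⟩ := exists_dressed_factorization ha hN hP hf hu hdef
  rw [dressed_eq ha hN hP hf hu hdef]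
  refine ⟨isNegativeLoop_simpleElement_mul _ _ _ _, hf', ⟨?_, ?_⟩, g, hg, ?_⟩
  · exact differentiable_matrix_iff.1 (differentiable_dressedLoop (differentiable_dressedLoop hf))
  · exact isUnit_dressedTwiceLoop ha hN hP hf hu hdef
  · have hfin : ({a, -a} : Set ℂ).Finite := Set.toFinite _
    filter_upwards [hfin.compl_mem_cofinite] with z hz
    simp only [Set.mem_compl_iff, Set.mem_insert_iff, Set.mem_singleton_iff, not_or] at hz
    exact hgf z hz.1 hz.2

end Dressed
end TwistedLoops

/-! ### Reality and twisting conditions -/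

section Symmetries
open Filter

variable {n : ℕ}

attribute [local instance] Matrix.linftyOpNormedRing matrixNormedAlgebra matrixCompleteSpace

theorem differentiable_ringInverse {𝔸 : Type*} [NormedRing 𝔸] [NormedAlgebra ℂ 𝔸]
    [CompleteSpace 𝔸] {f : ℂ → 𝔸} (hf : Differentiable ℂ f) (hu : ∀ z, IsUnit (f z)) :
    Differentiable ℂ fun z => Ring.inverse (f z) := by
  intro z
  obtain ⟨u, hu⟩ := hu z
  have h := hasFDerivAt_ringInverse (𝕜 := ℂ) u
  rw [hu] at h
  exact h.differentiableAt.comp z (hf z)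

theorem eventually_cobounded_ne (a : ℂ) : ∀ᶠ z in Bornology.cobounded ℂ, z ≠ a := by
  have h : ({a} : Set ℂ)ᶜ ∈ Bornology.cobounded ℂ :=
    Bornology.isBounded_def.1 Bornology.isBounded_singleton
  exact h

theorem tendsto_conj_cobounded :
    Tendsto (starRingEnd ℂ) (Bornology.cobounded ℂ) (Bornology.cobounded ℂ) := by
  rw [← tendsto_norm_atTop_iff_cobounded]
  simpa using tendsto_norm_cobounded_atTop (E := ℂ)

theorem map_conj_mul (A B : Matrix (Fin n) (Fin n) ℂ) :
    (A * B).map (starRingEnd ℂ) = A.map (starRingEnd ℂ) * B.map (starRingEnd ℂ) := Matrix.map_mul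

theorem map_conj_eq (A : Matrix (Fin n) (Fin n) ℂ) : A.map (starRingEnd ℂ) = Aᴴᵀ := by
  ext i j
  simp

theorem map_conj_inv (A : Matrix (Fin n) (Fin n) ℂ) :
    (A⁻¹).map (starRingEnd ℂ) = (A.map (starRingEnd ℂ))⁻¹ := by
  rw [map_conj_eq, map_conj_eq, Matrix.conjTranspose_nonsing_inv, Matrix.transpose_nonsing_inv]

theorem map_conj_add (A B : Matrix (Fin n) (Fin n) ℂ) :
    (A + B).map (starRingEnd ℂ) = A.map (starRingEnd ℂ) + B.map (starRingEnd ℂ) :=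
  Matrix.map_add _ (map_add _) _ _

theorem map_conj_sub (A B : Matrix (Fin n) (Fin n) ℂ) :
    (A - B).map (starRingEnd ℂ) = A.map (starRingEnd ℂ) - B.map (starRingEnd ℂ) :=
  Matrix.map_sub _ (map_sub _) _ _

theorem map_conj_smul (c : ℂ) (A : Matrix (Fin n) (Fin n) ℂ) :
    (c • A).map (starRingEnd ℂ) = (starRingEnd ℂ c) • A.map (starRingEnd ℂ) := by
  ext i j
  simp

theorem map_conj_one : (1 : Matrix (Fin n) (Fin n) ℂ).map (starRingEnd ℂ) = 1 :=
  Matrix.map_one _ (map_zero _) (map_one _)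

theorem map_conj_map_ofReal (A : Matrix (Fin n) (Fin n) ℝ) :
    (A.map Complex.ofReal).map (starRingEnd ℂ) = A.map Complex.ofReal := by
  ext i j
  simp

theorem map_conj_twistPartner (α : ℝ) (N : Matrix (Fin n) (Fin n) ℝ) :
    (twistPartner (α : ℂ) (N.map Complex.ofReal)).map (starRingEnd ℂ) =
      twistPartner (α : ℂ) (N.map Complex.ofReal) := by
  have hT : (N.map Complex.ofReal)ᵀ.map (starRingEnd ℂ) = (N.map Complex.ofReal)ᵀ := by
    ext i j
    simp
  simp only [twistPartner, map_conj_mul, map_conj_add, map_conj_sub, map_conj_inv, map_conj_smul,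
    map_conj_one, map_conj_map_ofReal, hT, map_div₀, map_one, map_mul, map_pow, map_ofNat,
    Complex.conj_ofReal]

theorem map_conj_simpleElement (a z : ℂ) (M : Matrix (Fin n) (Fin n) ℂ) :
    (simpleElement a M z).map (starRingEnd ℂ) =
      simpleElement (starRingEnd ℂ a) (M.map (starRingEnd ℂ)) (starRingEnd ℂ z) := by
  simp only [simpleElement, map_conj_add, map_conj_smul, map_conj_one, map_inv₀, map_sub]

theorem map_conj_twistedElement (α : ℝ) (N : Matrix (Fin n) (Fin n) ℝ) (z : ℂ) :
    (twistedElement (α : ℂ) (N.map Complex.ofReal) z).map (starRingEnd ℂ) =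
      twistedElement (α : ℂ) (N.map Complex.ofReal) (starRingEnd ℂ z) := by
  simp only [twistedElement, map_conj_mul, map_conj_simpleElement, map_conj_twistPartner,
    map_conj_map_ofReal, map_neg, Complex.conj_ofReal]

/-- The reality condition for a loop. -/
def IsRealLoop (f : ℂ → Matrix (Fin n) (Fin n) ℂ) : Prop :=
  ∀ z, (f (starRingEnd ℂ z)).map (starRingEnd ℂ) = f z

/-- The twisting condition for a loop. -/
def IsTwistedLoop (f : ℂ → Matrix (Fin n) (Fin n) ℂ) : Prop :=
  ∀ z, f z * (f (-z))ᵀ = 1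

section Dressed

variable {α : ℝ} {N : Matrix (Fin n) (Fin n) ℝ} {f : ℂ → Matrix (Fin n) (Fin n) ℂ}
  (hα : α ≠ 0) (hN : N * N = 0) (hf : Differentiable ℂ f) (hu : ∀ z, IsUnit (f z))
  (hdef : DressingDefined (α : ℂ) (N.map Complex.ofReal) f)

theorem map_ofReal_mul_self (hN : N * N = 0) : N.map Complex.ofReal * N.map Complex.ofReal = 0 := by
  have h := congrArg (Complex.ofRealHom.mapMatrix (m := Fin n)) hN
  rwa [map_mul, map_zero] at h

include hα hN hf hu hdef

/-- Since `s` and `f` are real, conjugating the factorization `s f = F g` gives another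
factorization of the same loop, and uniqueness identifies the two. -/
theorem isRealLoop_dressedTwiceLoop (hreal : IsRealLoop f) :
    IsRealLoop (dressedTwiceLoop (α : ℂ) (N.map Complex.ofReal) f) := by
  have hα' : (α : ℂ) ≠ 0 := Complex.ofReal_ne_zero.2 hα
  have hN' := map_ofReal_mul_self hN
  have hP := (twistPartner_relations hN' (isUnit_one_add_smul_transpose_mul_self N (α := α))).1
  obtain ⟨g, hg, hgf⟩ := exists_dressed_factorization hα' hN' hP hf hu hdef
  set F := dressedTwiceLoop (α : ℂ) (N.map Complex.ofReal) f with hF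
  have hFd : Differentiable ℂ F := differentiable_dressedLoop (differentiable_dressedLoop hf)
  have hFu : ∀ z, IsUnit (F z) := isUnit_dressedTwiceLoop hα' hN' hP hf hu hdef
  refine congrFun (birkhoff_unique (f₁ := fun z => (F (starRingEnd ℂ z)).map (starRingEnd ℂ))
    (g₁ := fun z => (g (starRingEnd ℂ z)).map (starRingEnd ℂ)) (g₂ := g) ?_ hFd hFu ?_ hg.2 ?_)
  · refine differentiable_matrix_iff.2 fun i j z => ?_
    exact differentiableAt_conj_conj_iff.2 (differentiable_matrix_iff.1 hFd i j _)
  · have h1 : Continuous fun M : Matrix (Fin n) (Fin n) ℂ => M.map (starRingEnd ℂ) :=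
      continuous_id.matrix_map Complex.continuous_conj
    have h2 := (h1.tendsto 1).comp (hg.2.comp tendsto_conj_cobounded)
    rw [map_conj_one] at h2
    exact h2
  · filter_upwards [eventually_cobounded_ne (α : ℂ), eventually_cobounded_ne (-α : ℂ)] with z h1 h2
    have h3 := hgf (starRingEnd ℂ z)
      (fun h => h1 (by rw [← Complex.conj_conj z, h, Complex.conj_ofReal]))
      (fun h => h2 (by rw [← Complex.conj_conj z, h, map_neg, Complex.conj_ofReal]))
    rw [← map_conj_mul, ← h3, map_conj_mul, map_conj_twistedElement, Complex.conj_conj, hreal,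
      hgf z h1 h2]

/-- The same argument with the involution `f(z) ↦ (f(-z)ᵗ)⁻¹`, which fixes both `s` and `f`. -/
theorem isTwistedLoop_dressedTwiceLoop (htwist : IsTwistedLoop f) :
    IsTwistedLoop (dressedTwiceLoop (α : ℂ) (N.map Complex.ofReal) f) := by
  have hα' : (α : ℂ) ≠ 0 := Complex.ofReal_ne_zero.2 hα
  have hN' := map_ofReal_mul_self hN
  have hinv := isUnit_one_add_smul_transpose_mul_self N (α := α)
  have hP := (twistPartner_relations hN' hinv).1
  obtain ⟨g, hg, hgf⟩ := exists_dressed_factorization hα' hN' hP hf hu hdef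
  set F := dressedTwiceLoop (α : ℂ) (N.map Complex.ofReal) f with hF
  have hFd : Differentiable ℂ F := differentiable_dressedLoop (differentiable_dressedLoop hf)
  have hFu : ∀ z, IsUnit (F z) := isUnit_dressedTwiceLoop hα' hN' hP hf hu hdef
  have hneg : Tendsto (fun z : ℂ => -z) (Bornology.cobounded ℂ) (Bornology.cobounded ℂ) := by
    rw [← tendsto_norm_atTop_iff_cobounded]
    simpa using tendsto_norm_cobounded_atTop (E := ℂ)
  have key : (fun z => Ring.inverse ((F (-z))ᵀ)) = F := by
    refine birkhoff_unique (g₁ := fun z => Ring.inverse ((g (-z))ᵀ)) (g₂ := g) ?_ hFd hFu ?_ hg.2 ?_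
    · refine differentiable_ringInverse (f := fun z => (F (-z))ᵀ) ?_ fun z => ?_
      · refine differentiable_matrix_iff.2 fun i j => ?_
        exact (differentiable_matrix_iff.1 hFd j i).comp differentiable_neg
      · exact (Matrix.isUnit_transpose _).2 (hFu (-z))
    · have h1 : Continuous fun M : Matrix (Fin n) (Fin n) ℂ => Mᵀ := continuous_id.matrix_transpose
      have h2 := (h1.tendsto 1).comp (hg.2.comp hneg)
      rw [Matrix.transpose_one] at h2
      have h3 := (NormedRing.inverse_continuousAt (1 : (Matrix (Fin n) (Fin n) ℂ)ˣ)).tendsto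
      simp only [Units.val_one, Ring.inverse_one] at h3
      exact h3.comp h2
    · filter_upwards [eventually_cobounded_ne (α : ℂ), eventually_cobounded_ne (-α : ℂ)]
        with z h1 h2
      have h3 := hgf (-z) (fun h => h2 (by rw [← h, neg_neg])) (fun h => h1 (neg_injective h))
      have h4 := twistedElement_twist hα' hN' hinv h1 h2
      rw [← Matrix.nonsing_inv_eq_ringInverse, ← Matrix.nonsing_inv_eq_ringInverse,
        ← Matrix.mul_inv_rev, ← Matrix.transpose_mul, ← h3, ← hgf z h1 h2, Matrix.transpose_mul,
        Matrix.mul_inv_rev, Matrix.inv_eq_right_inv h4,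
        Matrix.inv_eq_left_inv (htwist z)]
  intro z
  have h5 := congrFun key z
  rw [← h5]
  exact Ring.inverse_mul_cancel _ ((Matrix.isUnit_transpose _).2 (hFu (-z)))

end Dressed

section Frames

theorem hasFDerivAt_transpose {X : Type*} [NormedAddCommGroup X] [NormedSpace ℝ X]
    {F : X → Matrix (Fin n) (Fin n) ℂ} {F' : OneForm X (Matrix (Fin n) (Fin n) ℂ)} {x : X}
    (h : HasFDerivAt F F' x) : ∃ G : OneForm X (Matrix (Fin n) (Fin n) ℂ),
      HasFDerivAt (fun y => (F y)ᵀ) G x ∧ ∀ v, G v = (F' v)ᵀ := by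
  choose G hG hGv using fun j k => hasFDerivAt_entry h k j
  have key : ∀ (e : OneForm X (Matrix (Fin n) (Fin n) ℂ)), (∀ v, e v = (F' v)ᵀ) →
      ∃ G : OneForm X (Matrix (Fin n) (Fin n) ℂ),
        HasFDerivAt (fun y => (F y)ᵀ) G x ∧ ∀ v, G v = (F' v)ᵀ := fun e he =>
    ⟨e, hasFDerivAt_of_entry hG fun j k v => by rw [he, hGv]; rfl, he⟩
  exact key (((LinearMap.toContinuousLinearMap (Matrix.transposeLinearEquiv (Fin n) (Fin n) ℂ ℂ :
    Matrix (Fin n) (Fin n) ℂ →ₗ[ℂ] Matrix (Fin n) (Fin n) ℂ)).restrictScalars ℝ).comp F')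
    fun _ => rfl

/-- The derivative of `F₁ F₂ᵗ` is `F₁ (φ₁ + φ₂ᵗ) F₂ᵗ = 0`, and `U` is connected. -/
theorem mul_transpose_eq_one {X : Type*} [NormedAddCommGroup X] [NormedSpace ℝ X] {U : Set X}
    (hU : IsOpen U) (hUc : IsPreconnected U)
    {F₁ F₂ : X → Matrix (Fin n) (Fin n) ℂ} {φ₁ φ₂ : X → OneForm X (Matrix (Fin n) (Fin n) ℂ)}
    (h₁ : ∀ x ∈ U, HasFDerivAt F₁ (leftMul (F₁ x) (φ₁ x)) x)
    (h₂ : ∀ x ∈ U, HasFDerivAt F₂ (leftMul (F₂ x) (φ₂ x)) x)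
    (hφ : ∀ x ∈ U, ∀ v, φ₁ x v + (φ₂ x v)ᵀ = 0) {p : X} (hp : p ∈ U)
    (hp₁ : F₁ p = 1) (hp₂ : F₂ p = 1) {x : X} (hx : x ∈ U) : F₁ x * (F₂ x)ᵀ = 1 := by
  have hd : ∀ x ∈ U, HasFDerivAt (𝕜 := ℝ) (fun x => F₁ x * (F₂ x)ᵀ) 0 x := by
    intro x hx
    obtain ⟨G, hG, hGv⟩ := hasFDerivAt_transpose (h₂ x hx)
    refine ((h₁ x hx).mul' hG).congr_fderiv ?_
    ext v : 1
    have h3 : F₁ x * G v + F₁ x * φ₁ x v * (F₂ x)ᵀ = 0 := by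
      rw [hGv, leftMul_apply, Matrix.transpose_mul]
      calc _ = F₁ x * (φ₁ x v + (φ₂ x v)ᵀ) * (F₂ x)ᵀ := by noncomm_ring
        _ = 0 := by rw [hφ x hx, mul_zero, zero_mul]
    exact h3
  have h4 := hU.is_const_of_fderiv_eq_zero (𝕜 := ℝ) hUc
    (fun x hx => (hd x hx).differentiableAt.differentiableWithinAt) (fun x hx => (hd x hx).fderiv)
    hx hp
  simpa [hp₁, hp₂] using h4

theorem diagForm_transpose (v : Fin n → ℝ) : (diagForm n v)ᵀ = diagForm n v := by
  simp only [diagForm, coordForm_apply, Matrix.transpose_sum, Matrix.transpose_smul,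
    Matrix.transpose_single]

theorem map_conj_diagForm (v : Fin n → ℝ) : (diagForm n v).map (starRingEnd ℂ) = diagForm n v := by
  have h : (starRingEnd ℂ).mapMatrix (diagForm n v) = diagForm n v := by
    simp only [diagForm, coordForm_apply, map_sum]
    refine Finset.sum_congr rfl fun i _ => ?_
    rw [RingHom.mapMatrix_apply, map_conj_smul, Complex.conj_ofReal]
    congr 1
    ext j k
    simp [Matrix.single_apply, apply_ite (starRingEnd ℂ)]
  exact h

variable {U : Set (Fin n → ℝ)} {β : (Fin n → ℝ) → Matrix (Fin n) (Fin n) ℝ}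
  {E : (Fin n → ℝ) → ℂ → Matrix (Fin n) (Fin n) ℂ}

theorem frameForm_add_transpose {B : Matrix (Fin n) (Fin n) ℝ} (hB : Bᵀ = B) (z : ℂ)
    (v : Fin n → ℝ) :
    frameForm (diagForm n) (B.map Complex.ofReal) z v +
      (frameForm (diagForm n) (B.map Complex.ofReal) (-z) v)ᵀ = 0 := by
  have h1 : (B.map Complex.ofReal)ᵀ = B.map Complex.ofReal := by
    rw [← Matrix.transpose_map, hB]
  simp only [frameForm_apply, Matrix.transpose_add, Matrix.transpose_sub, Matrix.transpose_smul,
    Matrix.transpose_mul, diagForm_transpose, h1]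
  module

theorem isTwistedLoop_frame (hU : IsOpen U) (hUc : IsPreconnected U) (h0 : (0 : Fin n → ℝ) ∈ U)
    (hE : IsHolomorphicFrame (diagForm n) (fun x => (β x).map Complex.ofReal) E U)
    (hβ : ∀ x ∈ U, (β x)ᵀ = β x) (hE0 : ∀ z, E 0 z = 1) {x : Fin n → ℝ} (hx : x ∈ U) :
    IsTwistedLoop (E x) := fun z =>
  mul_transpose_eq_one hU hUc (fun x hx => hE.solves x hx z trivial)
    (fun x hx => hE.solves x hx (-z) trivial) (fun x hx v => frameForm_add_transpose (hβ x hx) z v)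
    h0 (hE0 z) (hE0 (-z)) hx

theorem isRealLoop_frame (hU : IsOpen U) (hUc : IsPreconnected U) (h0 : (0 : Fin n → ℝ) ∈ U)
    (hE : IsHolomorphicFrame (diagForm n) (fun x => (β x).map Complex.ofReal) E U)
    (hβ : ∀ x ∈ U, (β x)ᵀ = β x) (hE0 : ∀ z, E 0 z = 1) {x : Fin n → ℝ} (hx : x ∈ U) :
    IsRealLoop (E x) := by
  intro z
  have hc : ∀ x ∈ U, HasFDerivAt (fun x => (E x (starRingEnd ℂ z)).map (starRingEnd ℂ))
      (leftMul ((E x (starRingEnd ℂ z)).map (starRingEnd ℂ))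
        (frameForm (diagForm n) ((β x).map Complex.ofReal) z)) x := by
    intro x hx
    choose G hG hGv using hasFDerivAt_entry (hE.solves x hx (starRingEnd ℂ z) trivial)
    refine hasFDerivAt_of_entry (G := fun j k => (Complex.conjCLE : ℂ →L[ℝ] ℂ).comp (G j k))
      (fun j k => Complex.conjCLE.hasFDerivAt.comp x (hG j k)) fun j k v => ?_
    have h1 : ((Complex.conjCLE : ℂ →L[ℝ] ℂ).comp (G j k)) v = starRingEnd ℂ (G j k v) := rfl
    have h2 : (frameForm (diagForm n) ((β x).map Complex.ofReal) (starRingEnd ℂ z) v).map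
        (starRingEnd ℂ) = frameForm (diagForm n) ((β x).map Complex.ofReal) z v := by
      simp only [frameForm_apply, map_conj_add, map_conj_sub, map_conj_mul, map_conj_smul,
        map_conj_diagForm, map_conj_map_ofReal, Complex.conj_conj]
    rw [h1, hGv, leftMul_apply, leftMul_apply, ← h2, ← map_conj_mul, Matrix.map_apply]
  have h3 := mul_transpose_eq_one hU hUc hc (fun x hx => hE.solves x hx (-z) trivial)
    (fun x hx v => frameForm_add_transpose (hβ x hx) z v) h0
    (by simp only [hE0, map_conj_one]) (hE0 (-z)) hx
  have h4 := isTwistedLoop_frame hU hUc h0 hE hβ hE0 hx z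
  have h5 : IsUnit ((E x (-z))ᵀ) := (Matrix.isUnit_transpose _).2 (hE.isUnit x hx (-z))
  -- The conjugated loop solves the same equation as `E(x,z)`, so both are inverse to `E(x,-z)ᵗ`.
  exact h5.mul_left_injective (h3.trans h4.symm)

end Frames
end Symmetries

/-! ### From a real twisted frame to the metric and its Lagrangian immersions -/

section Geometry
open Filter

variable {n : ℕ}

attribute [local instance] Matrix.linftyOpNormedRing matrixNormedAlgebra matrixCompleteSpace

theorem diagForm_mulVec (v : Fin n → ℝ) (w : Fin n → ℂ) :
    diagForm n v *ᵥ w = fun i => (v i : ℂ) * w i := by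
  have h : diagForm n v = Matrix.diagonal fun i => (v i : ℂ) := by
    rw [diagForm, coordForm_apply]
    ext i j
    rw [Matrix.sum_apply]
    by_cases h : i = j
    · subst h
      simp [Matrix.single_apply]
    · rw [Matrix.diagonal_apply_ne _ h]
      refine Finset.sum_eq_zero fun k _ => ?_
      rw [Matrix.smul_apply, Matrix.single_apply, if_neg (by rintro ⟨rfl, rfl⟩; exact h rfl),
        smul_zero]
  rw [h]
  ext i
  exact Matrix.mulVec_diagonal _ _ _

theorem hasFDerivAt_mulVec {X : Type*} [NormedAddCommGroup X] [NormedSpace ℝ X]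
    {Y : X → Matrix (Fin n) (Fin n) ℂ} {δ : OneForm X (Matrix (Fin n) (Fin n) ℂ)} {x : X}
    (h : HasFDerivAt Y δ x) (c : Fin n → ℂ) :
    ∃ G : X →L[ℝ] (Fin n → ℂ), HasFDerivAt (fun y => Y y *ᵥ c) G x ∧ ∀ v, G v = δ v *ᵥ c := by
  choose G hG hGv using hasFDerivAt_entry h
  refine ⟨ContinuousLinearMap.pi fun i => ∑ j, (G i j).smulRight (c j),
    hasFDerivAt_pi.2 fun i => ?_, fun v => ?_⟩
  · change HasFDerivAt (fun y => ∑ j, Y y i j • c j) _ x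
    exact HasFDerivAt.fun_sum fun j _ => (hG i j).smul_const (c j)
  ext i
  simp [Matrix.mulVec, dotProduct, hGv]

theorem contDiffOn_mulVec {X : Type*} [NormedAddCommGroup X] [NormedSpace ℝ X]
    {Y : X → Matrix (Fin n) (Fin n) ℂ} {V : Set X} {k : WithTop ℕ∞} (h : ContDiffOn ℝ k Y V)
    {c : X → Fin n → ℂ} (hc : ContDiffOn ℝ k c V) : ContDiffOn ℝ k (fun y => Y y *ᵥ c y) V := by
  refine contDiffOn_pi.2 fun i => ?_
  change ContDiffOn ℝ k (fun y => ∑ j, Y y i j * c y j) V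
  exact ContDiffOn.sum fun j _ => (contDiffOn_entry h i j).mul (contDiffOn_pi.1 hc j)

theorem hasFDerivAt_re {X : Type*} [NormedAddCommGroup X] [NormedSpace ℝ X] {f : X → Fin n → ℂ}
    {f' : X →L[ℝ] (Fin n → ℂ)} {x : X} (h : HasFDerivAt f f' x) :
    ∃ G : X →L[ℝ] (Fin n → ℝ), HasFDerivAt (fun y i => (f y i).re) G x ∧
      ∀ v, G v = fun i => (f' v i).re :=
  ⟨ContinuousLinearMap.pi fun i => Complex.reCLM.comp ((ContinuousLinearMap.proj i).comp f'),
    hasFDerivAt_pi.2 fun i => Complex.reCLM.hasFDerivAt.comp x (hasFDerivAt_pi'.1 h i),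
    fun _ => rfl⟩

theorem contDiffOn_re {X : Type*} [NormedAddCommGroup X] [NormedSpace ℝ X] {f : X → Fin n → ℂ}
    {V : Set X} {k : WithTop ℕ∞} (h : ContDiffOn ℝ k f V) :
    ContDiffOn ℝ k (fun y i => (f y i).re) V :=
  contDiffOn_pi.2 fun i => Complex.reCLM.contDiff.comp_contDiffOn (contDiffOn_pi.1 h i)

theorem im_eq_zero_of_hasFDerivAt {X : Type*} [NormedAddCommGroup X] [NormedSpace ℝ X]
    {f : X → Fin n → ℂ} {f' : X →L[ℝ] (Fin n → ℂ)} {x : X} (h : HasFDerivAt f f' x)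
    (hr : ∀ᶠ y in 𝓝 x, ∀ i, (f y i).im = 0) (v : X) (i : Fin n) : (f' v i).im = 0 := by
  have h1 : HasFDerivAt (fun y => (f y i).im) _ x :=
    Complex.imCLM.hasFDerivAt.comp x (hasFDerivAt_pi'.1 h i)
  have h2 : HasFDerivAt (fun y => (f y i).im) (0 : X →L[ℝ] ℝ) x :=
    (hasFDerivAt_const (0 : ℝ) x).congr_of_eventuallyEq (hr.mono fun y hy => hy i)
  exact DFunLike.congr_fun (h1.unique h2) v

/-- The connection does not see the diagonal. This matters because the dressed `B` need not have
zero diagonal, whereas a rotation matrix has. -/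
theorem commutator_single_congr {R : Type*} [Ring R] {A B : Matrix (Fin n) (Fin n) R}
    (h : ∀ i j, i ≠ j → A i j = B i j) (i : Fin n) :
    Matrix.single i i 1 * A - A * Matrix.single i i 1 =
      Matrix.single i i 1 * B - B * Matrix.single i i 1 := by
  ext j k
  by_cases hj : i = j <;> by_cases hk : i = k
  · subst hj; subst hk; simp
  · subst hj; simp [Matrix.mul_apply, Matrix.single_apply, hk, h i k hk]
  · subst hk; simp [Matrix.mul_apply, Matrix.single_apply, hj, h j i (Ne.symm hj)]
  · simp [Matrix.mul_apply, hj, hk]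

theorem commutator_single_mulVec_of_ne {B : Matrix (Fin n) (Fin n) ℂ} {i j : Fin n} (h : i ≠ j)
    (w : Fin n → ℂ) :
    ((Matrix.single j j 1 * B - B * Matrix.single j j 1) *ᵥ w) i = -(B i j * w j) := by
  have h1 : (B *ᵥ fun l => (((Pi.single j 1 : Fin n → ℝ) l : ℝ) : ℂ) * w l) i = B i j * w j := by
    rw [Matrix.mulVec, dotProduct, Finset.sum_eq_single j (fun k _ hk => by simp [hk]) (by simp)]
    simp
  rw [Matrix.sub_mulVec, ← Matrix.mulVec_mulVec, ← Matrix.mulVec_mulVec, ← diagForm_single,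
    diagForm_mulVec, diagForm_mulVec, Pi.sub_apply, h1]
  simp [h]

theorem star_mulVec_dotProduct_mulVec {g : Matrix (Fin n) (Fin n) ℂ} (hg : gᴴ * g = 1)
    (u w : Fin n → ℂ) : star (g *ᵥ u) ⬝ᵥ (g *ᵥ w) = star u ⬝ᵥ w := by
  rw [Matrix.star_mulVec, Matrix.dotProduct_mulVec, Matrix.vecMul_vecMul, hg, Matrix.vecMul_one]

theorem star_dotProduct_single (η : Fin n → ℝ) (i j : Fin n) :
    star (fun l => (((Pi.single i 1 : Fin n → ℝ) l : ℝ) : ℂ) * (η l : ℂ)) ⬝ᵥ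
      (fun l => (((Pi.single j 1 : Fin n → ℝ) l : ℝ) : ℂ) * (η l : ℂ)) =
      ((Matrix.diagonal (fun i => η i ^ 2) i j : ℝ) : ℂ) := by
  simp only [dotProduct, Pi.star_apply, star_mul', RCLike.star_def, Complex.conj_ofReal]
  by_cases h : i = j
  · subst h
    rw [Finset.sum_eq_single i]
    · simp [sq]
    · intro k _ hk
      simp [hk]
    · simp
  · rw [Matrix.diagonal_apply_ne _ h, Finset.sum_eq_zero]
    · simp
    intro k _
    by_cases hk : k = i
    · subst hk
      simp [h]
    · simp [hk]

theorem re_dotProduct_re {p q : Fin n → ℂ} (hp : ∀ l, (p l).im = 0) (hq : ∀ l, (q l).im = 0) :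
    (((fun l => (p l).re) ⬝ᵥ (fun l => (q l).re) : ℝ) : ℂ) = star p ⬝ᵥ q := by
  simp only [dotProduct, Complex.ofReal_sum, Complex.ofReal_mul, Pi.star_apply]
  refine Finset.sum_congr rfl fun l _ => ?_
  apply Complex.ext <;> simp [hp, hq]

theorem im_mulVec_eq_zero {g : Matrix (Fin n) (Fin n) ℂ} (hg : g.map (starRingEnd ℂ) = g)
    {w : Fin n → ℂ} (hw : ∀ i, (w i).im = 0) (i : Fin n) : ((g *ᵥ w) i).im = 0 := by
  have h : ∀ i j, (g i j).im = 0 := fun i j => by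
    rw [← Complex.conj_eq_iff_im]
    exact congrFun (congrFun hg i) j
  simp [Matrix.mulVec, dotProduct, h, hw]

/-- The frame of a real twisted family of loops. -/
structure IsTwistedFrame (B : (Fin n → ℝ) → Matrix (Fin n) (Fin n) ℂ)
    (F : (Fin n → ℝ) → ℂ → Matrix (Fin n) (Fin n) ℂ) (V : Set (Fin n → ℝ)) : Prop where
  holomorphic : IsHolomorphicFrame (diagForm n) B F V
  real : ∀ x ∈ V, IsRealLoop (F x)
  twisted : ∀ x ∈ V, IsTwistedLoop (F x)

/-- The real part of `F(x, 0)⁻¹ c`. -/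
def metricCoeff (F : (Fin n → ℝ) → ℂ → Matrix (Fin n) (Fin n) ℂ) (c : Fin n → ℝ)
    (x : Fin n → ℝ) : Fin n → ℝ := fun i => (reconstruct F c x i).re

/-- The flat coordinates of the metric with coefficients `F(x, 0)⁻¹ c`. -/
def flatCoord (F : (Fin n → ℝ) → ℂ → Matrix (Fin n) (Fin n) ℂ) (c : Fin n → ℝ)
    (x : Fin n → ℝ) : Fin n → ℝ :=
  fun i => ((logDerivAt (F x) 0 *ᵥ fun j => (c j : ℂ)) i).re

namespace IsTwistedFrame

variable {B : (Fin n → ℝ) → Matrix (Fin n) (Fin n) ℂ}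
  {F : (Fin n → ℝ) → ℂ → Matrix (Fin n) (Fin n) ℂ} {V : Set (Fin n → ℝ)}
  (hF : IsTwistedFrame B F V) (c : Fin n → ℝ)

include hF

theorem mono {W : Set (Fin n → ℝ)} (hW : W ⊆ V) : IsTwistedFrame B F W :=
  ⟨hF.holomorphic.mono hW, fun x hx => hF.real x (hW hx), fun x hx => hF.twisted x (hW hx)⟩

theorem map_conj {x : Fin n → ℝ} (hx : x ∈ V) (z : ℂ) :
    (F x z).map (starRingEnd ℂ) = F x (starRingEnd ℂ z) := by
  have h := hF.real x hx (starRingEnd ℂ z)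
  rwa [Complex.conj_conj] at h

/-- On the imaginary axis reality turns the twisting condition into unitarity. The value `z = 0`
serves the flat metric, `z = it` the immersions. -/
theorem conjTranspose_mul_self {x : Fin n → ℝ} (hx : x ∈ V) {z : ℂ} (hz : starRingEnd ℂ z = -z) :
    (F x z)ᴴ * F x z = 1 := by
  have h : (F x z)ᴴ = (F x (-z))ᵀ := by
    rw [← hz, ← hF.map_conj hx z, map_conj_eq, Matrix.transpose_transpose]
  rw [h]
  exact mul_eq_one_comm.1 (hF.twisted x hx z)

theorem im_reconstruct {x : Fin n → ℝ} (hx : x ∈ V) (i : Fin n) :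
    (reconstruct F c x i).im = 0 := by
  refine im_mulVec_eq_zero ?_ (fun i => by simp) i
  rw [map_conj_inv, hF.map_conj hx, map_zero]

theorem metricCoeff_coe {x : Fin n → ℝ} (hx : x ∈ V) :
    (fun i => (metricCoeff F c x i : ℂ)) = reconstruct F c x :=
  funext fun i => Complex.ext rfl (by simp [hF.im_reconstruct c hx i])

theorem contDiffOn_reconstruct (hV : IsOpen V) : ContDiffOn ℝ ∞ (reconstruct F c) V := by
  have h : ContDiffOn ℝ ∞ (fun x => Ring.inverse (F x 0)) V :=
    contDiffOn_ringInverse (hF.holomorphic.contDiffOn hV 0) fun x hx =>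
      hF.holomorphic.isUnit x hx 0
  have h2 := contDiffOn_mulVec h (contDiffOn_const (c := fun i => (c i : ℂ)))
  simp only [← Matrix.nonsing_inv_eq_ringInverse] at h2
  exact h2

theorem contDiffOn_metricCoeff (hV : IsOpen V) : ContDiffOn ℝ ∞ (metricCoeff F c) V :=
  contDiffOn_re (hF.contDiffOn_reconstruct c hV)

/-- This is `dh = -[D, B] h`, the frame equation at `z = 0` for the inverse. For `i ≠ j` the right
side is `Bᵢⱼ hⱼ`. -/
theorem pderiv_metricCoeff (hV : IsOpen V) {x : Fin n → ℝ} (hx : x ∈ V) (i j : Fin n) :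
    ((pderiv (fun y => metricCoeff F c y i) j x : ℝ) : ℂ) =
      -((Matrix.single j j 1 * B x - B x * Matrix.single j j 1) *ᵥ reconstruct F c x) i := by
  have h1 := hF.holomorphic.solves.hasFDerivAt_inverse hx (Set.mem_univ 0)
    (hF.holomorphic.isUnit x hx 0)
  obtain ⟨G, hG, hGv⟩ := hasFDerivAt_mulVec h1 (fun i => (c i : ℂ))
  simp only [← Matrix.nonsing_inv_eq_ringInverse] at hG
  obtain ⟨H, hH, hHv⟩ := hasFDerivAt_re hG
  have h2 : HasFDerivAt (fun y => metricCoeff F c y i) _ x := hasFDerivAt_pi'.1 hH i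
  have him := im_eq_zero_of_hasFDerivAt hG (Filter.eventually_of_mem (hV.mem_nhds hx)
    fun y hy i => hF.im_reconstruct c hy i) (Pi.single j 1) i
  have h3 : pderiv (fun y => metricCoeff F c y i) j x = (G (Pi.single j 1) i).re := by
    rw [pderiv, h2.fderiv]
    exact congrFun (hHv (Pi.single j 1)) i
  have h4 : ((pderiv (fun y => metricCoeff F c y i) j x : ℝ) : ℂ) = G (Pi.single j 1) i := by
    rw [h3]
    exact Complex.ext rfl (by simp [him])
  have h5 : (-((ContinuousLinearMap.mul ℝ (Matrix (Fin n) (Fin n) ℂ)).flip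
      (Ring.inverse (F x 0))).comp (frameForm (diagForm n) (B x) 0) :
        OneForm (Fin n → ℝ) (Matrix (Fin n) (Fin n) ℂ)) (Pi.single j 1) =
      -((Matrix.single j j 1 * B x - B x * Matrix.single j j 1) * (F x 0)⁻¹) := by
    simp only [neg_apply, ContinuousLinearMap.comp_apply, ContinuousLinearMap.flip_apply,
      ContinuousLinearMap.mul_apply', frameForm_apply, diagForm_single, zero_smul, zero_add,
      Matrix.nonsing_inv_eq_ringInverse]
  rw [h4, hGv, h5, Matrix.neg_mulVec, ← Matrix.mulVec_mulVec]
  rfl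

/-- The matrices `aⱼ` sum to the identity, so the commutators with `B` sum to zero. -/
theorem isInvariant_metricCoeff (hV : IsOpen V) : IsInvariant (metricCoeff F c) V := by
  intro x hx i
  rw [← Complex.ofReal_inj, Complex.ofReal_sum]
  simp only [hF.pderiv_metricCoeff c hV hx]
  have h1 : ∑ j, (Matrix.single j j 1 * B x - B x * Matrix.single j j 1) = 0 := by
    rw [Finset.sum_sub_distrib, ← Finset.sum_mul, ← Finset.mul_sum, Matrix.sum_single_one]
    simp
  rw [Finset.sum_neg_distrib, ← Finset.sum_apply, ← Matrix.sum_mulVec, h1]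
  simp

theorem connectionCoeff_rotationMatrix (hV : IsOpen V)
    (hne : ∀ x ∈ V, ∀ i, metricCoeff F c x i ≠ 0) {x : Fin n → ℝ} (hx : x ∈ V) (i : Fin n)
    (z : ℂ) : connectionCoeff (rotationMatrix (metricCoeff F c) x) i z =
      frameForm (diagForm n) (B x) z (Pi.single i 1) := by
  rw [connectionCoeff, frameForm_apply, diagForm_single]
  congr 1
  refine commutator_single_congr (fun j k hjk => ?_) i
  rw [Matrix.map_apply, rotationMatrix, Matrix.of_apply, if_neg hjk, Complex.ofReal_div,
    hF.pderiv_metricCoeff c hV hx, commutator_single_mulVec_of_ne hjk,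
    ← congrFun (hF.metricCoeff_coe c hx) k, neg_neg,
    mul_div_cancel_right₀ _ (Complex.ofReal_ne_zero.2 (hne x hx k))]

theorem isFrame (hV : IsOpen V) (hne : ∀ x ∈ V, ∀ i, metricCoeff F c x i ≠ 0)
    (h0 : ∀ z, F 0 z = 1) : IsFrame (rotationMatrix (metricCoeff F c)) F V := by
  refine ⟨fun z j k => contDiffOn_entry (hF.holomorphic.contDiffOn hV z) j k,
    hF.holomorphic.isUnit, fun x hx z i => ?_, h0⟩
  rw [hF.connectionCoeff_rotationMatrix c hV hne hx]
  have h1 : pderivMatrix (fun y => F y z) i x =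
      F x z * frameForm (diagForm n) (B x) z (Pi.single i 1) := by
    ext j k
    obtain ⟨G, hG, hGv⟩ := hasFDerivAt_entry (hF.holomorphic.solves x hx z trivial) j k
    rw [pderivMatrix, Matrix.of_apply, pderiv, hG.fderiv, hGv, leftMul_apply]
  rw [h1, Matrix.nonsing_inv_mul_cancel_left]
  exact (Matrix.isUnit_iff_isUnit_det _).1 (hF.holomorphic.isUnit x hx z)

theorem hasFDerivAt_mulVec_of_sandwich {Y : (Fin n → ℝ) → Matrix (Fin n) (Fin n) ℂ}
    {x : Fin n → ℝ} (hx : x ∈ V) {g : Matrix (Fin n) (Fin n) ℂ}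
    (h : HasFDerivAt Y (sandwich g (diagForm n) (Ring.inverse (F x 0))) x) :
    ∃ G : (Fin n → ℝ) →L[ℝ] (Fin n → ℂ),
      HasFDerivAt (fun y => Y y *ᵥ fun i => (c i : ℂ)) G x ∧
        ∀ v, G v = g *ᵥ fun i => (v i : ℂ) * (metricCoeff F c x i : ℂ) := by
  obtain ⟨G, hG, hGv⟩ := hasFDerivAt_mulVec h (fun i => (c i : ℂ))
  refine ⟨G, hG, fun v => ?_⟩
  rw [hGv, sandwich_apply, ← Matrix.mulVec_mulVec, ← Matrix.mulVec_mulVec, diagForm_mulVec,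
    ← Matrix.nonsing_inv_eq_ringInverse]
  congr 1
  ext i
  rw [congrFun (hF.metricCoeff_coe c hx) i]
  rfl

theorem contDiffOn_flatCoord (hV : IsOpen V) : ContDiffOn ℝ ∞ (flatCoord F c) V :=
  contDiffOn_re (contDiffOn_mulVec (hF.holomorphic.contDiffOn_logDerivAt hV 0) contDiffOn_const)

theorem hasFDerivAt_flatCoord (hV : IsOpen V) {x : Fin n → ℝ} (hx : x ∈ V) :
    ∃ G : (Fin n → ℝ) →L[ℝ] (Fin n → ℝ), HasFDerivAt (flatCoord F c) G x ∧
      ∀ v, G v = fun l => ((F x 0 *ᵥ fun i => (v i : ℂ) * (metricCoeff F c x i : ℂ)) l).re := by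
  obtain ⟨G, hG, hGv⟩ := hF.hasFDerivAt_mulVec_of_sandwich c hx
    (hF.holomorphic.hasFDerivAt_logDerivAt hV 0 hx)
  obtain ⟨H, hH, hHv⟩ := hasFDerivAt_re hG
  exact ⟨H, hH, fun v => by rw [hHv, hGv]⟩

theorem im_frame_mulVec {x : Fin n → ℝ} (hx : x ∈ V) (v : Fin n → ℝ) (l : Fin n) :
    ((F x 0 *ᵥ fun i => (v i : ℂ) * (metricCoeff F c x i : ℂ)) l).im = 0 := by
  refine im_mulVec_eq_zero ?_ (fun i => by simp) l
  rw [hF.map_conj hx, map_zero]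

/-- The differential of `flatCoord` at `x` is `v ↦ F(x,0) (vᵢ hᵢ)`, and `F(x,0)` preserves the
scalar product. -/
theorem isFlatMetric (hV : IsOpen V) :
    IsFlatMetric (fun x => Matrix.diagonal fun i => metricCoeff F c x i ^ 2) V := by
  refine fun p hp => ⟨V, hV, hp, subset_rfl, flatCoord F c, hF.contDiffOn_flatCoord c hV,
    fun x hx i j => ?_⟩
  obtain ⟨G, hG, hGv⟩ := hF.hasFDerivAt_flatCoord c hV hx
  rw [pderiv, pderiv, hG.fderiv, hGv, hGv, ← Complex.ofReal_inj,
    re_dotProduct_re (hF.im_frame_mulVec c hx _) (hF.im_frame_mulVec c hx _),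
    star_mulVec_dotProduct_mulVec (hF.conjTranspose_mul_self hx (by simp)),
    star_dotProduct_single]

theorem exists_potential (hV : IsOpen V) : ∃ φ : (Fin n → ℝ) → ℝ, ContDiffOn ℝ ∞ φ V ∧
    ∀ x ∈ V, ∀ i, metricCoeff F c x i ^ 2 = pderiv φ i x := by
  -- The potential is `c · y`: its `i`-th derivative is `(F(x,0)ᵗ c)ᵢ hᵢ`, which is `hᵢ²` because
  -- `F(x,0)ᵗ = F(x,0)⁻¹`.
  refine ⟨fun x => ∑ l, c l * flatCoord F c x l, ContDiffOn.sum fun l _ => contDiffOn_const.mul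
    (contDiffOn_pi.1 (hF.contDiffOn_flatCoord c hV) l), fun x hx i => ?_⟩
  obtain ⟨G, hG, hGv⟩ := hF.hasFDerivAt_flatCoord c hV hx
  have h1 : HasFDerivAt (fun x => ∑ l, c l * flatCoord F c x l) _ x :=
    HasFDerivAt.fun_sum fun l _ => (hasFDerivAt_pi'.1 hG l).const_mul (c l)
  set u : Fin n → ℂ := fun l => (((Pi.single i 1 : Fin n → ℝ) l : ℝ) : ℂ) *
    (metricCoeff F c x l : ℂ) with hu
  have h2 : pderiv (fun x => ∑ l, c l * flatCoord F c x l) i x =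
      ∑ l, c l * ((F x 0 *ᵥ u) l).re := by
    rw [pderiv, h1.fderiv, sum_apply]
    refine Finset.sum_congr rfl fun l _ => ?_
    rw [smul_apply, ContinuousLinearMap.comp_apply, ContinuousLinearMap.proj_apply, hGv,
      smul_eq_mul]
  have h3 : (F x 0)⁻¹ = (F x 0)ᵀ := by
    refine Matrix.inv_eq_right_inv ?_
    simpa using hF.twisted x hx 0
  have h4 : ((∑ l, c l * ((F x 0 *ᵥ u) l).re : ℝ) : ℂ) =
      (fun l => (c l : ℂ)) ⬝ᵥ (F x 0 *ᵥ u) := by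
    rw [dotProduct, Complex.ofReal_sum]
    refine Finset.sum_congr rfl fun l _ => ?_
    rw [Complex.ofReal_mul]
    congr 1
    exact Complex.ext rfl (by simp [u, hF.im_frame_mulVec c hx])
  rw [h2, ← Complex.ofReal_inj, h4, Matrix.dotProduct_mulVec, ← Matrix.mulVec_transpose, ← h3]
  change _ = reconstruct F c x ⬝ᵥ u
  rw [← hF.metricCoeff_coe c hx, dotProduct, Finset.sum_eq_single i]
  · simp [u, sq]
  · intro k _ hk
    simp [u, hk]
  · simp

theorem isFlatEgoroffMetric (hV : IsOpen V) (hne : ∀ x ∈ V, ∀ i, metricCoeff F c x i ≠ 0) :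
    IsFlatEgoroffMetric (metricCoeff F c) V :=
  ⟨hF.contDiffOn_metricCoeff c hV, hne, hF.exists_potential c hV, hF.isFlatMetric c hV⟩

theorem associatedFamily_eq {x : Fin n → ℝ} (hx : x ∈ V) (hc : metricCoeff F c 0 = c) (t : ℝ) :
    associatedFamily F (metricCoeff F c) t x =
      (-Complex.I * (t : ℂ)⁻¹) • (F x (Complex.I * t) *ᵥ reconstruct F c x -
        fun i => (c i : ℂ)) := by
  rw [associatedFamily, hF.metricCoeff_coe c hx, hc]

theorem hasFDerivAt_associatedFamily (hV : IsOpen V) (hc : metricCoeff F c 0 = c) {t : ℝ}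
    (ht : t ≠ 0) {x : Fin n → ℝ} (hx : x ∈ V) :
    ∃ G : (Fin n → ℝ) →L[ℝ] (Fin n → ℂ),
      HasFDerivAt (associatedFamily F (metricCoeff F c) t) G x ∧
        ∀ v, G v = F x (Complex.I * t) *ᵥ fun i => (v i : ℂ) * (metricCoeff F c x i : ℂ) := by
  have hz : Complex.I * t ≠ 0 := mul_ne_zero Complex.I_ne_zero (Complex.ofReal_ne_zero.2 ht)
  obtain ⟨G, hG, hGv⟩ := hF.hasFDerivAt_mulVec_of_sandwich c hx
    (hF.holomorphic.solves.hasFDerivAt_slope hx (hF.holomorphic.isUnit x hx 0) hz)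
  refine ⟨G, hG.congr_of_eventuallyEq (Filter.eventually_of_mem (hV.mem_nhds hx) fun y hy => ?_),
    hGv⟩
  -- As `(it)⁻¹ = -i t⁻¹`, the associated family is a slope applied to `c`, so `hasFDerivAt_slope`
  -- gives its differential.
  change _ = slope (fun w => F y w * Ring.inverse (F y 0)) 0 (Complex.I * t) *ᵥ
    fun i => (c i : ℂ)
  rw [hF.associatedFamily_eq c hy hc, slope_def_module, sub_zero,
    Ring.mul_inverse_cancel _ (hF.holomorphic.isUnit y hy 0), Matrix.smul_mulVec,
    Matrix.sub_mulVec, ← Matrix.mulVec_mulVec, ← Matrix.nonsing_inv_eq_ringInverse,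
    Matrix.one_mulVec, mul_inv, Complex.inv_I]
  rfl

theorem hermitianForm_associatedFamily (hV : IsOpen V) (hc : metricCoeff F c 0 = c) {t : ℝ}
    (ht : t ≠ 0) {x : Fin n → ℝ} (hx : x ∈ V) (i j : Fin n) :
    hermitianForm (associatedFamily F (metricCoeff F c) t) i j x =
      ((Matrix.diagonal (fun i => metricCoeff F c x i ^ 2) i j : ℝ) : ℂ) := by
  obtain ⟨G, hG, hGv⟩ := hF.hasFDerivAt_associatedFamily c hV hc ht hx
  rw [hermitianForm, pderiv, pderiv, hG.fderiv, hGv, hGv,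
    star_mulVec_dotProduct_mulVec (hF.conjTranspose_mul_self hx (by simp)),
    star_dotProduct_single]

theorem isFlatLagrangianImmersion (hV : IsOpen V)
    (hne : ∀ x ∈ V, ∀ i, metricCoeff F c x i ≠ 0) (hc : metricCoeff F c 0 = c) {t : ℝ}
    (ht : t ≠ 0) :
    IsFlatLagrangianImmersion (associatedFamily F (metricCoeff F c) t) V := by
  refine ⟨?_, fun x hx => ?_, fun x hx i j => ?_, fun p hp => ?_⟩
  · have h1 := contDiffOn_mulVec (hF.holomorphic.contDiffOn hV (Complex.I * t))
      (hF.contDiffOn_reconstruct c hV)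
    exact ((h1.sub contDiffOn_const).const_smul (-Complex.I * (t : ℂ)⁻¹)).congr fun x hx =>
      hF.associatedFamily_eq c hx hc t
  · obtain ⟨G, hG, hGv⟩ := hF.hasFDerivAt_associatedFamily c hV hc ht hx
    rw [hG.fderiv]
    intro v w hvw
    rw [hGv, hGv] at hvw
    have h1 := Matrix.mulVec_injective_of_isUnit (hF.holomorphic.isUnit x hx _) hvw
    ext i
    have h2 := congrFun h1 i
    exact Complex.ofReal_injective
      (mul_right_cancel₀ (Complex.ofReal_ne_zero.2 (hne x hx i)) h2)
  · rw [hF.hermitianForm_associatedFamily c hV hc ht hx, Complex.ofReal_im]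
  · obtain ⟨W, hW, hpW, hWV, y, hy, hyg⟩ := hF.isFlatMetric c hV p hp
    refine ⟨W, hW, hpW, hWV, y, hy, fun x hx i j => ?_⟩
    rw [hyg x hx]
    change _ = (hermitianForm (associatedFamily F (metricCoeff F c) t) i j x).re
    rw [hF.hermitianForm_associatedFamily c hV hc ht (hWV hx),
      Complex.ofReal_re]

end IsTwistedFrame
end Geometry

/-! ### Smoothness and symmetry of the rotation coefficients -/

section RotationCoefficients

variable {n : ℕ} {U : Set (Fin n → ℝ)} {h : (Fin n → ℝ) → (Fin n → ℝ)}

theorem contDiffOn_pderiv {f : (Fin n → ℝ) → ℝ} (hU : IsOpen U) (hf : ContDiffOn ℝ ∞ f U)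
    (i : Fin n) : ContDiffOn ℝ ∞ (pderiv f i) U :=
  (hf.fderiv_of_isOpen hU (m := ∞) (by simp)).clm_apply contDiffOn_const

theorem pderiv_comm {f : (Fin n → ℝ) → ℝ} (hU : IsOpen U) (hf : ContDiffOn ℝ ∞ f U)
    {x : Fin n → ℝ} (hx : x ∈ U) (i j : Fin n) :
    pderiv (pderiv f i) j x = pderiv (pderiv f j) i x := by
  have h1 : IsSymmSndFDerivAt ℝ f x :=
    (hf.contDiffAt (hU.mem_nhds hx)).isSymmSndFDerivAt
      (by rw [minSmoothness_of_isRCLikeNormedField]; exact WithTop.coe_le_coe.2 (le_top : (2 : ℕ∞) ≤ ⊤))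
  have h2 : DifferentiableAt ℝ (fderiv ℝ f) x :=
    ((hf.fderiv_of_isOpen hU (m := ∞) (by simp)).contDiffAt (hU.mem_nhds hx)).differentiableAt
      (by simp)
  have h3 : ∀ i j, pderiv (pderiv f i) j x =
      fderiv ℝ (fderiv ℝ f) x (Pi.single j 1) (Pi.single i 1) := fun i j => by
    have h4 : HasFDerivAt (pderiv f i) _ x :=
      h2.hasFDerivAt.clm_apply (hasFDerivAt_const (Pi.single i (1 : ℝ) : Fin n → ℝ) x)
    rw [pderiv, h4.fderiv]
    simp
  rw [h3, h3]
  exact h1 _ _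

theorem contDiffOn_rotationMatrix (hU : IsOpen U) (hE : IsFlatEgoroffMetric h U) (i j : Fin n) :
    ContDiffOn ℝ ∞ (fun x => rotationMatrix h x i j) U := by
  by_cases hij : i = j
  · simp only [rotationMatrix, Matrix.of_apply, if_pos hij]
    exact contDiffOn_const
  · simp only [rotationMatrix, Matrix.of_apply, if_neg hij]
    exact (contDiffOn_pderiv hU (contDiffOn_pi.1 hE.smooth i) j).div
      (contDiffOn_pi.1 hE.smooth j) fun x hx => hE.ne_zero x hx j

/-- Differentiating `hᵢ² = ∂φ/∂xᵢ` gives `2 hᵢ ∂ⱼhᵢ = ∂ⱼ∂ᵢφ`, which is symmetric in `i` and `j`. -/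
theorem rotationMatrix_transpose (hU : IsOpen U) (hE : IsFlatEgoroffMetric h U)
    {x : Fin n → ℝ} (hx : x ∈ U) : (rotationMatrix h x)ᵀ = rotationMatrix h x := by
  obtain ⟨φ, hφ, hφh⟩ := hE.egoroff
  have h1 : ∀ i j, 2 * (h x i * pderiv (fun y => h y i) j x) = pderiv (pderiv φ i) j x := by
    intro i j
    have h2 : HasFDerivAt (fun y => h y i) (fderiv ℝ (fun y => h y i) x) x :=
      (((contDiffOn_pi.1 hE.smooth i).contDiffAt (hU.mem_nhds hx)).differentiableAt
        (by simp)).hasFDerivAt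
    have h3 := (h2.pow 2).congr_of_eventuallyEq (f₁ := pderiv φ i)
      (Filter.eventually_of_mem (hU.mem_nhds hx) fun y hy => (hφh y hy i).symm)
    rw [pderiv, pderiv, h3.fderiv]
    simp
    ring
  ext i j
  rw [Matrix.transpose_apply, rotationMatrix, Matrix.of_apply, Matrix.of_apply]
  by_cases hij : i = j
  · subst hij; rfl
  rw [if_neg hij, if_neg (Ne.symm hij), div_eq_div_iff (hE.ne_zero x hx i) (hE.ne_zero x hx j)]
  have := h1 i j
  have := h1 j i
  have := pderiv_comm hU hφ hx i j
  linarith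

end RotationCoefficients

/-! ### The dressed frame and its domain -/

section DressedFrame

variable {n : ℕ}

attribute [local instance] Matrix.linftyOpNormedRing matrixNormedAlgebra matrixCompleteSpace

theorem logDerivAt_const {𝔸 : Type*} [NormedRing 𝔸] [NormedAlgebra ℂ 𝔸] (b : 𝔸) (a : ℂ) :
    logDerivAt (fun _ => b) a = 0 := by
  simp [logDerivAt]

/-- Difference quotients of a constant loop vanish. As `E(0,·) = 1`, this places `0` in the domain
and preserves the initial condition. -/
theorem dressedOnceLoop_one {a : ℂ} {N : Matrix (Fin n) (Fin n) ℂ} :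
    dressedOnceLoop a N (fun _ => 1) = fun _ => 1 := by
  have h1 : dslope (fun _ : ℂ => (1 : Matrix (Fin n) (Fin n) ℂ)) a = 0 := by
    funext z
    rcases eq_or_ne z a with rfl | hz
    · simp
    · simp [dslope_of_ne _ hz, slope]
  have h2 : dslope (0 : ℂ → Matrix (Fin n) (Fin n) ℂ) a = 0 := by
    funext z
    rcases eq_or_ne z a with rfl | hz
    · simp
    · simp [dslope_of_ne _ hz, slope]
  funext z
  simp [dressedOnceLoop, dressedLoop, h1, h2]

theorem dressingDefined_one {a : ℂ} (ha : a ≠ 0) {N : Matrix (Fin n) (Fin n) ℂ}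
    (hN : N * N = 0) : DressingDefined a N (fun _ => 1) := by
  rw [dressingDefined_iff hN (differentiable_const _) (fun _ => isUnit_one) ha,
    dressedOnceLoop_one, logDerivAt_const, logDerivAt_const]
  simp

variable {U : Set (Fin n → ℝ)} {β : (Fin n → ℝ) → Matrix (Fin n) (Fin n) ℝ}
  {E : (Fin n → ℝ) → ℂ → Matrix (Fin n) (Fin n) ℂ} {α : ℝ} {N : Matrix (Fin n) (Fin n) ℝ}

/-- The points of `U` at which the dressing of `E` with `s_{α,N}` is well-defined. -/
def dressingDomain (α : ℝ) (N : Matrix (Fin n) (Fin n) ℝ)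
    (E : (Fin n → ℝ) → ℂ → Matrix (Fin n) (Fin n) ℂ) (U : Set (Fin n → ℝ)) : Set (Fin n → ℝ) :=
  {x ∈ U | DressingDefined (α : ℂ) (N.map Complex.ofReal) (E x)}

/-- Two applications of `dress`, first at `α` with `N`, then at `-α` with `N'`. Each step need not
respect the symmetries; only the composite does. -/
theorem dressed_frame (hU : IsOpen U) (hUc : IsPreconnected U) (h0 : (0 : Fin n → ℝ) ∈ U)
    (hE : IsHolomorphicFrame (diagForm n) (fun x => (β x).map Complex.ofReal) E U)
    (hβ : ∀ x ∈ U, (β x)ᵀ = β x) (hE0 : ∀ z, E 0 z = 1) (hα : α ≠ 0) (hN : N * N = 0) :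
    IsOpen (dressingDomain α N E U) ∧ (0 : Fin n → ℝ) ∈ dressingDomain α N E U ∧
    (∀ x ∈ dressingDomain α N E U, IsDressing (twistedElement (α : ℂ) (N.map Complex.ofReal))
      (E x) (dressedFrame α N E x)) ∧
    (∀ z, dressedFrame α N E 0 z = 1) ∧
    ∃ B, IsTwistedFrame B (dressedFrame α N E) (dressingDomain α N E U) := by
  have hα' : (α : ℂ) ≠ 0 := Complex.ofReal_ne_zero.2 hα
  have hN' := map_ofReal_mul_self hN
  have hP := (twistPartner_relations hN' (isUnit_one_add_smul_transpose_mul_self N (α := α))).1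
  set M := N.map Complex.ofReal with hM
  set V₁ := dressingSet (α : ℂ) M E U with hV₁
  set E₁ : (Fin n → ℝ) → ℂ → Matrix (Fin n) (Fin n) ℂ := fun x => dressedOnceLoop (α : ℂ) M (E x)
    with hE₁
  have hF₁ : IsHolomorphicFrame (diagForm n) _ E₁ V₁ := hE.dress hU hN'
  have hV₁o : IsOpen V₁ := hE.isOpen_dressingSet hU (α : ℂ) M
  set V₂ := dressingSet (-(α : ℂ)) (twistPartner (α : ℂ) M) E₁ V₁ with hV₂
  have hF₂ := hF₁.dress hV₁o (a := -(α : ℂ)) hP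
  have hV₂o : IsOpen V₂ := hF₁.isOpen_dressingSet hV₁o _ _
  have hdom : dressingDomain α N E U = V₂ := by
    ext x
    constructor
    · rintro ⟨hx, hd⟩
      obtain ⟨h1, h2⟩ := (dressingDefined_iff hN' (hE.differentiable x hx) (hE.isUnit x hx) hα').1 hd
      exact ⟨⟨hx, h1⟩, h2⟩
    · rintro ⟨⟨hx, h1⟩, h2⟩
      exact ⟨hx, (dressingDefined_iff hN' (hE.differentiable x hx) (hE.isUnit x hx) hα').2 ⟨h1, h2⟩⟩
  have hE0' : E 0 = fun _ => 1 := funext hE0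
  have h0' : (0 : Fin n → ℝ) ∈ dressingDomain α N E U := by
    refine ⟨h0, ?_⟩
    rw [hE0']
    exact dressingDefined_one hα' hN'
  have heq : ∀ x ∈ dressingDomain α N E U,
      dressedFrame α N E x = dressedTwiceLoop (α : ℂ) M (E x) := fun x hx =>
    dressed_eq hα' hN' hP (hE.differentiable x hx.1) (hE.isUnit x hx.1) hx.2
  refine ⟨hdom ▸ hV₂o, h0', fun x hx => ?_, fun z => ?_, fun x => (β x).map Complex.ofReal -
    dressedElement (α : ℂ) M (E x) - dressedElement (-(α : ℂ)) (twistPartner (α : ℂ) M) (E₁ x),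
    ?_, fun x hx => ?_, fun x hx => ?_⟩
  · exact isDressing_dressed hα' hN' hP (hE.differentiable x hx.1) (hE.isUnit x hx.1) hx.2
      ⟨differentiable_matrix_iff.1 (hE.differentiable x hx.1), hE.isUnit x hx.1⟩
  · rw [heq 0 h0', dressedTwiceLoop, hE0', dressedOnceLoop_one, dressedOnceLoop_one]
  · rw [← hV₂, ← hdom] at hF₂
    exact hF₂.congr (hdom ▸ hV₂o) heq
  · rw [heq x hx]
    exact isRealLoop_dressedTwiceLoop hα hN (hE.differentiable x hx.1) (hE.isUnit x hx.1) hx.2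
      (isRealLoop_frame hU hUc h0 hE hβ hE0 hx.1)
  · rw [heq x hx]
    exact isTwistedLoop_dressedTwiceLoop hα hN (hE.differentiable x hx.1) (hE.isUnit x hx.1) hx.2
      (isTwistedLoop_frame hU hUc h0 hE hβ hE0 hx.1)

end DressedFrame

theorem isOpen_dressedDomain {n : ℕ} {B : (Fin n → ℝ) → Matrix (Fin n) (Fin n) ℂ}
    {F : (Fin n → ℝ) → ℂ → Matrix (Fin n) (Fin n) ℂ} {V : Set (Fin n → ℝ)}
    (hF : IsTwistedFrame B F V) (hV : IsOpen V) (c : Fin n → ℝ) :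
    IsOpen {x ∈ V | ∀ i, reconstruct F c x i ≠ 0} :=
  (hF.contDiffOn_reconstruct c hV).continuousOn.isOpen_inter_preimage (t := {w : Fin n → ℂ | ∀ i, w i ≠ 0}) hV
    (by
      simp only [Set.ofPred_forall]
      exact isOpen_iInter_of_finite fun i => isOpen_ne_fun (continuous_apply i) continuous_const)

end FlatEgoroff
end

theorem mainTheorem10 {n : ℕ} (U : Set (Fin n → ℝ)) (hU : IsOpen U) (hUconn : IsConnected U)
    (h0 : (0 : Fin n → ℝ) ∈ U)
    (h : (Fin n → ℝ) → (Fin n → ℝ))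
    (hEgoroff : FlatEgoroff.IsFlatEgoroffMetric h U) (hinv : FlatEgoroff.IsInvariant h U)
    (E Ehat : (Fin n → ℝ) → ℂ → Matrix (Fin n) (Fin n) ℂ)
    (hE : FlatEgoroff.IsFrame (FlatEgoroff.rotationMatrix h) E U)
    (α : ℝ) (hα : α ≠ 0) (N : Matrix (Fin n) (Fin n) ℝ) (hN : N * N = 0)
    (hEhat : Ehat = FlatEgoroff.dressedFrame α N E)
    (chat : Fin n → ℝ) (hchat : ∀ i, chat i ≠ 0)
    (V : Set (Fin n → ℝ)) (hV : V = FlatEgoroff.dressedDomain α N E chat U) :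
    IsOpen V ∧ (0 : Fin n → ℝ) ∈ V ∧
    (∀ x ∈ V, FlatEgoroff.IsDressing
      (FlatEgoroff.twistedElement (α : ℂ) (N.map Complex.ofReal)) (E x) (Ehat x)) ∧
    ∃ hhat : (Fin n → ℝ) → (Fin n → ℝ),
      (∀ x ∈ V, (fun i => (hhat x i : ℂ)) = (Ehat x 0)⁻¹ *ᵥ fun i => (chat i : ℂ)) ∧
      FlatEgoroff.IsFlatEgoroffMetric hhat V ∧ FlatEgoroff.IsInvariant hhat V ∧
      FlatEgoroff.IsFrame (FlatEgoroff.rotationMatrix hhat) Ehat V ∧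
      ∀ t : ℝ, t ≠ 0 →
        FlatEgoroff.IsFlatLagrangianImmersion (FlatEgoroff.associatedFamily Ehat hhat t) V ∧
        ∀ x ∈ V, FlatEgoroff.associatedFamily Ehat hhat t x =
          (-Complex.I * (t : ℂ)⁻¹) •
            (Ehat x (Complex.I * t) *ᵥ ((Ehat x 0)⁻¹ *ᵥ fun i => (chat i : ℂ)) -
              fun i => (chat i : ℂ)) := by
  have hβ := fun x (hx : x ∈ U) => FlatEgoroff.rotationMatrix_transpose hU hEgoroff hx
  have hEf := FlatEgoroff.isHolomorphicFrame_of_isFrame hU hUconn.isPreconnected h0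
    (FlatEgoroff.contDiffOn_rotationMatrix hU hEgoroff) hE
  obtain ⟨hWo, hW0, hWd, hE0, B, hF⟩ := FlatEgoroff.dressed_frame hU hUconn.isPreconnected h0 hEf
    hβ hE.initial hα hN
  rw [← hEhat] at hWd hE0 hF
  have hVW : V = {x ∈ FlatEgoroff.dressingDomain α N E U |
      ∀ i, FlatEgoroff.reconstruct Ehat chat x i ≠ 0} := by
    rw [hV, hEhat]
    ext x
    simp only [FlatEgoroff.dressedDomain, FlatEgoroff.dressingDomain, Set.mem_ofPred_eq, and_assoc]
  have hVo : IsOpen V := hVW ▸ FlatEgoroff.isOpen_dressedDomain hF hWo chat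
  -- At the origin the new metric has coefficients `chat`. Hence `0 ∈ V`, and `chat` is the constant
  -- subtracted in the associated family.
  have hrec0 : FlatEgoroff.reconstruct Ehat chat 0 = fun i => (chat i : ℂ) := by
    rw [FlatEgoroff.reconstruct, hE0, inv_one, Matrix.one_mulVec]
  have hcoeff0 : FlatEgoroff.metricCoeff Ehat chat 0 = chat := by
    funext i
    rw [FlatEgoroff.metricCoeff, hrec0, Complex.ofReal_re]
  have hsub : V ⊆ FlatEgoroff.dressingDomain α N E U := fun x hx => (hVW ▸ hx).1
  have hFV := hF.mono hsub
  have hne : ∀ x ∈ V, ∀ i, FlatEgoroff.metricCoeff Ehat chat x i ≠ 0 := fun x hx i hi => by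
    have h1 : ∀ i, FlatEgoroff.reconstruct Ehat chat x i ≠ 0 := (hVW ▸ hx).2
    refine h1 i ?_
    rw [← congrFun (hFV.metricCoeff_coe chat hx) i, hi, Complex.ofReal_zero]
  refine ⟨hVo, ?_, fun x hx => hWd x (hsub hx), FlatEgoroff.metricCoeff Ehat chat,
    fun x hx => hFV.metricCoeff_coe chat hx, hFV.isFlatEgoroffMetric chat hVo hne,
    hFV.isInvariant_metricCoeff chat hVo, hFV.isFrame chat hVo hne hE0, fun t ht =>
    ⟨hFV.isFlatLagrangianImmersion chat hVo hne hcoeff0 ht, fun x hx =>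
      hFV.associatedFamily_eq chat hx hcoeff0 t⟩⟩
  rw [hVW]
  refine ⟨hW0, fun i => ?_⟩
  rw [hrec0]
  exact Complex.ofReal_ne_zero.2 (hchat i)
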